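/- Let $L^p_+(\mathbb{R})$ $(1\le p\le\infty)$ be the space of functions in $L^p(\mathbb{R};\mathbb{C})$ whose Fourier transform (as a tempered distribution) is supported in $[0,+\infty)$, let $\Pi$ be the orthogonal projector of $L^2(\mathbb{R})$ onto $L^2_+(\mathbb{R})$, and let $D=\frac1i\frac{d}{dx}$. Let $\alpha>0$ and let $u\in L^{2,\alpha}_+(\mathbb{R})=\{u\in L^2_+(\mathbb{R}):\ |x|^\alpha u\in L^2(\mathbb{R})\}$. For $m\in L^\infty(\mathbb{R})$ put \[ L_u m = Dm + u\,\Pi(\bar u\, m), \] which is a tempered distribution, since $\Pi(\bar u m)\in L^2(\mathbb{R})$ and so $u\,\Pi(\bar u m)\in L^1(\mathbb{R})$. For $\lambda>0$ let \[ \mathscr M_u(\lambda)=\{\,m\in L^\infty_+(\mathbb{R}) : (L_u-\lambda)m=0 \text{ in the sense of distributions}\,\}. \] Then, for every $\lambda>0$: 1. $\mathscr M_u(\lambda)$ is a complex vector space of dimension one. 2. Every $m\in\mathscr M_u(\lambda)$ has a continuous representative, and for this representative the limits \[ \ell_m(\pm\infty)=\lim_{x\to\pm\infty}e^{-i\lambda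 x}m(x) \] exist in $\mathbb{C}$ and satisfy $|\ell_m(+\infty)|=|\ell_m(-\infty)|$. 3. $\ell_m(-\infty)$ characterizes $m$: for every $\ell\in\mathbb{C}$ there is exactly one $m\in\mathscr M_u(\lambda)$ with $\ell_m(-\infty)=\ell$. -/

import Mathlib

open MeasureTheory Filter Topology
open scoped ENNReal SchwartzMap FourierTransform

noncomputable section

namespace CMDNLS

/-- The Hardy space `L^p_+(ℝ)`: the functions in `L^p(ℝ; ℂ)` whose Fourier transform, as a tempered
distribution, is supported in `[0, ∞)`, that is, vanishes on `(-∞, 0)`. (The normalization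
`∫ e^{-2πixξ} f(x) dx` of the Fourier transform does not affect this condition.) -/
def hardy (p : ℝ≥0∞) [Fact (1 ≤ p)] : Submodule ℂ (Lp ℂ p (volume : Measure ℝ)) where
  carrier := {f | Distribution.IsVanishingOn
    (𝓕 (Lp.toTemperedDistributionCLM ℂ volume p f) : 𝓢'(ℝ, ℂ)) (Set.Iio 0)}
  zero_mem' := by
    intro φ _
    simp [TemperedDistribution.fourier_apply]
  add_mem' := by
    intro f g hf hg φ hφ
    have h1 := hf φ hφ
    have h2 := hg φ hφ
    rw [TemperedDistribution.fourier_apply] at h1 h2 ⊢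
    rw [map_add, _root_.add_apply, h1, h2, add_zero]
  smul_mem' := by
    intro c f hf φ hφ
    have h1 := hf φ hφ
    rw [TemperedDistribution.fourier_apply] at h1 ⊢
    rw [map_smul, _root_.smul_apply, h1, smul_zero]

theorem isClosed_hardy (p : ℝ≥0∞) [Fact (1 ≤ p)] :
    IsClosed (hardy p : Set (Lp ℂ p (volume : Measure ℝ))) := by
  have h : (hardy p : Set (Lp ℂ p (volume : Measure ℝ))) =
      ⋂ (φ : 𝓢(ℝ, ℂ)) (_ : tsupport φ ⊆ Set.Iio 0),
        {f | (Lp.toTemperedDistributionCLM ℂ volume p f : 𝓢'(ℝ, ℂ)) (𝓕 φ) = 0} := by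
    ext f
    simp only [Set.mem_iInter]
    exact Iff.rfl
  rw [h]
  refine isClosed_iInter fun φ => isClosed_iInter fun _ => ?_
  refine isClosed_eq ?_ continuous_const
  exact (PointwiseConvergenceCLM.evalCLM (RingHom.id ℂ) ℂ (𝓕 φ)).continuous.comp
    (Lp.toTemperedDistributionCLM ℂ volume p).continuous

instance hasOrthogonalProjection_hardy : (hardy 2).HasOrthogonalProjection :=
  haveI : CompleteSpace (hardy 2) := (isClosed_hardy 2).completeSpace_coe
  inferInstance

/-- The Riesz–Szegő projector `Π`: the orthogonal projector of `L²(ℝ)` onto `L²_+(ℝ)`. -/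
def szego : Lp ℂ 2 (volume : Measure ℝ) →L[ℂ] Lp ℂ 2 (volume : Measure ℝ) :=
  (hardy 2).starProjection

/-- The space `L^{2,α}_+(ℝ) = {u ∈ L²_+(ℝ) : |x|^α u ∈ L²(ℝ)}`. -/
def weightedHardy (α : ℝ) : Set (Lp ℂ 2 (volume : Measure ℝ)) :=
  {u | u ∈ hardy 2 ∧ MemLp (fun x : ℝ => ((|x| ^ α : ℝ) : ℂ) * u x) 2 volume}

/-- The operator `T_ū m = Π(ū m)`, from `L^∞(ℝ)` to `L²(ℝ)`, for `u ∈ L²(ℝ)`. -/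
def toeplitzConj (u : Lp ℂ 2 (volume : Measure ℝ)) :
    Lp ℂ ∞ (volume : Measure ℝ) →ₗ[ℂ] Lp ℂ 2 (volume : Measure ℝ) where
  toFun m := szego (star u • m)
  map_add' m n := by rw [Lp.add_smul, map_add]
  map_smul' c m := by rw [← Lp.smul_comm, map_smul, RingHom.id_apply]

/-- The Lax operator `L_u m = D m + u T_ū m` with `D = (1/i) d/dx`, for bounded `m`, as a tempered
distribution; here `u T_ū m` is a product of two square-integrable functions, hence in `L¹(ℝ)`. -/
def lax (u : Lp ℂ 2 (volume : Measure ℝ)) :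
    Lp ℂ ∞ (volume : Measure ℝ) →ₗ[ℂ] 𝓢'(ℝ, ℂ) where
  toFun m := (1 / Complex.I) •
      TemperedDistribution.derivCLM ℂ (Lp.toTemperedDistributionCLM ℂ volume ∞ m) +
    Lp.toTemperedDistributionCLM ℂ volume 1
      ((u • toeplitzConj u m : Lp ℂ 1 (volume : Measure ℝ)))
  map_add' m n := by
    simp only [map_add, Lp.add_smul, smul_add]
    abel
  map_smul' c m := by
    simp only [map_smul, ← Lp.smul_comm, RingHom.id_apply, smul_add]
    rw [smul_comm]

/-- The space `M_u(λ)` of all `m ∈ L^∞_+(ℝ)` with `L_u m = λ m` in the sense of distributions. -/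
def generalizedEigenspace (u : Lp ℂ 2 (volume : Measure ℝ)) (lam : ℝ) :
    Submodule ℂ (Lp ℂ ∞ (volume : Measure ℝ)) :=
  hardy ∞ ⊓ LinearMap.eqLocus (lax u)
    ((lam : ℂ) • (Lp.toTemperedDistributionCLM ℂ volume ∞ :
      Lp ℂ ∞ (volume : Measure ℝ) →L[ℂ] 𝓢'(ℝ, ℂ)).toLinearMap)

/-- `ℓ` is the limit of `e^{-iλx} m(x)` along `F` (which will be `x → -∞` or `x → +∞`), where the
class `m ∈ L^∞(ℝ)` has a continuous representative (necessarily unique) and `m(x)` denotes its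
values. -/
def HasAsymptoticValue (lam : ℝ) (m : Lp ℂ ∞ (volume : Measure ℝ)) (F : Filter ℝ) (ℓ : ℂ) :
    Prop :=
  ∃ f : ℝ → ℂ, Continuous f ∧ m =ᵐ[volume] f ∧
    Tendsto (fun x : ℝ => Complex.exp (-(Complex.I * lam * x)) * f x) F (𝓝 ℓ)

end CMDNLS

end

noncomputable section

namespace CMDNLS

/-! Put `f = e^{-iλx} m`, `w = ū e^{iλx}` and `p = ū m = w f`. The equation becomes `f' = -i w̄ Πp`
with integrable right side, so `f(x) = c + ∫_{-∞}^x (-i) w̄ Πp` (`exists_integral_form`). Hence `m`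
is continuous, and `e^{-iλx} m` has limits `c` at `-∞` and `c + ∫ (-i) w̄ Πp` at `+∞`. Their moduli
agree because `|f|²' = 2 Re(-i p̄ Πp)` and `⟨p, Πp⟩ = ‖Πp‖²` is real (`norm_add_integral_source`).
Everything else is existence and uniqueness for given `c`.

Uniqueness (`eq_zero_of_vanishing`). If `c = 0`, then `f` vanishes at both ends. Suppose `f ∈ L²`,
so that `p = w f ∈ L¹`. In frequency, the derivative of `|f|²` is the difference of two half-line
integrals of `conj p̂(ξ-η) p̂(ξ)`, over `ξ > 0` and `ξ > η`; only `0 < ξ < η` survives. Dividing by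
`η` and letting `η → 0+` gives `2π ∫ |f|² = -|∫ p|²` (`integral_primitive_eq`), and the sign forces
`f = 0`. That `f ∈ L²` comes from a bootstrap: decay of `Πp` gives decay of `f`, hence of `p = w f`,
and this returns to `Πp` because `Π` is bounded on `L²(⟨x⟩^{2σ} dx)` for `0 ≤ σ < 1/2`
(`memLp_weight_szego`). This weighted bound is proved as in Helson–Szegő, with bounded analytic
multipliers whose squares stay in a sector.

Existence (`exists_solution`). With `V h = -i w ∫_{-∞}^x w̄ h`, the unknown `h = Πp` satisfies `h -
ΠV h = Π(c w)`. The operator `V` is a norm limit of finite-rank operators, so the Fredholm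
alternative applies, and uniqueness excludes the eigenvalue `1`. The resulting `m` is in `L^∞_+`: it
combines the plane wave `e^{iλx}`, whose frequency is nonnegative, and an outgoing integral, which
superposes translates of the Hardy product `u Πp`. -/

open Set

/-! ### Primitives of integrable functions and integration by parts -/

/-- The primitive of `n` that vanishes at `-∞`. -/
def primitive (n : ℝ → ℂ) (x : ℝ) : ℂ := ∫ y in Iic x, n y

theorem primitive_sub {n : ℝ → ℂ} (hn : Integrable n) (x y : ℝ) :
    primitive n y - primitive n x = ∫ t in x..y, n t :=
  intervalIntegral.integral_Iic_sub_Iic hn.integrableOn hn.integrableOn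

theorem continuous_primitive {n : ℝ → ℂ} (hn : Integrable n) : Continuous (primitive n) := by
  have h : primitive n = fun x => primitive n 0 + ∫ t in (0 : ℝ)..x, n t := by
    funext x
    rw [← primitive_sub hn]; ring
  rw [h]
  exact continuous_const.add
    (intervalIntegral.continuous_primitive (fun a b => hn.intervalIntegrable) 0)

theorem tendsto_primitive_atTop {n : ℝ → ℂ} (hn : Integrable n) :
    Tendsto (primitive n) atTop (𝓝 (∫ x, n x)) :=
  (aecover_Iic tendsto_id).integral_tendsto_of_countably_generated hn

theorem primitive_add_integral_Ioi {n : ℝ → ℂ} (hn : Integrable n) (x : ℝ) :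
    primitive n x + ∫ y in Ioi x, n y = ∫ y, n y :=
  intervalIntegral.integral_Iic_add_Ioi hn.integrableOn hn.integrableOn

theorem tendsto_primitive_atBot {n : ℝ → ℂ} (hn : Integrable n) :
    Tendsto (primitive n) atBot (𝓝 0) := by
  have h : Tendsto (fun x => ∫ y in Ioi x, n y) atBot (𝓝 (∫ x, n x)) :=
    (aecover_Ioi tendsto_id).integral_tendsto_of_countably_generated hn
  have h2 : primitive n = fun x => (∫ y, n y) - ∫ y in Ioi x, n y := by
    funext x
    rw [← primitive_add_integral_Ioi hn x]; ring
  rw [h2]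
  simpa using h.const_sub (∫ y, n y)

theorem norm_primitive_le {n : ℝ → ℂ} (hn : Integrable n) (x : ℝ) :
    ‖primitive n x‖ ≤ ∫ y, ‖n y‖ :=
  (norm_integral_le_integral_norm _).trans
    (setIntegral_le_integral hn.norm (Eventually.of_forall fun _ => norm_nonneg _))

theorem integrable_mul_of_bounded {a b : ℝ → ℂ} (ha : Integrable a)
    (hb : AEStronglyMeasurable b volume) {C : ℝ} (hC : ∀ x, ‖b x‖ ≤ C) :
    Integrable (fun x => a x * b x) :=
  ha.mul_bdd hb (Eventually.of_forall hC)

theorem integrable_mul_primitive {a b : ℝ → ℂ} (ha : Integrable a) (hb : Integrable b) :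
    Integrable (fun x => a x * primitive b x) :=
  integrable_mul_of_bounded ha (continuous_primitive hb).aestronglyMeasurable
    (norm_primitive_le hb)

/-- Integration by parts for primitives of integrable functions. -/
theorem integral_mul_primitive {a b : ℝ → ℂ} (ha : Integrable a) (hb : Integrable b) :
    ∫ x, a x * primitive b x = (∫ x, a x) * (∫ x, b x) - ∫ y, b y * primitive a y := by
  have hab : Integrable (fun z : ℝ × ℝ => a z.1 * b z.2) (volume.prod volume) := ha.mul_prod hb
  have hmeas : MeasurableSet {z : ℝ × ℝ | z.2 ≤ z.1} :=
    measurableSet_le measurable_snd measurable_fst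
  have h1 : ∀ x, a x * primitive b x =
      ∫ y, ({z : ℝ × ℝ | z.2 ≤ z.1}.indicator (fun z : ℝ × ℝ => a z.1 * b z.2)) (x, y) := by
    intro x
    rw [primitive, ← integral_indicator measurableSet_Iic, ← integral_const_mul]
    congr 1; funext y
    by_cases h : y ≤ x <;> simp [indicator, h]
  have h2 : ∀ y, ∫ x, ({z : ℝ × ℝ | z.2 ≤ z.1}.indicator
      (fun z : ℝ × ℝ => a z.1 * b z.2)) (x, y) = (∫ x, a x) * b y - b y * primitive a y := by
    intro y
    have h3 : ∫ x, ({z : ℝ × ℝ | z.2 ≤ z.1}.indicator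
      (fun z : ℝ × ℝ => a z.1 * b z.2)) (x, y) = ∫ x in Ici y, a x * b y := by
      rw [← integral_indicator measurableSet_Ici]
      congr 1
    rw [h3, integral_mul_const, integral_Ici_eq_integral_Ioi, ← primitive_add_integral_Ioi ha y]
    ring
  calc ∫ x, a x * primitive b x
      = ∫ x, ∫ y, ({z : ℝ × ℝ | z.2 ≤ z.1}.indicator
          (fun z : ℝ × ℝ => a z.1 * b z.2)) (x, y) := by simp_rw [h1]
    _ = ∫ y, ∫ x, ({z : ℝ × ℝ | z.2 ≤ z.1}.indicator
          (fun z : ℝ × ℝ => a z.1 * b z.2)) (x, y) :=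
        integral_integral_swap (hab.indicator hmeas)
    _ = ∫ y, ((∫ x, a x) * b y - b y * primitive a y) := by simp_rw [h2]
    _ = _ := by
        rw [integral_sub (hb.const_mul _) (integrable_mul_primitive hb ha), integral_const_mul]

theorem primitive_indicator_Iic (n : ℝ → ℂ) (X x : ℝ) :
    primitive ((Iic X).indicator n) x = primitive n (min x X) := by
  rw [primitive, primitive, setIntegral_indicator measurableSet_Iic, Iic_inter_Iic]

theorem integral_conj_eq (f : ℝ → ℂ) :
    ∫ x, (starRingEnd ℂ) (f x) = (starRingEnd ℂ) (∫ x, f x) := integral_conj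

theorem primitive_conj (n : ℝ → ℂ) (x : ℝ) :
    primitive (fun y => (starRingEnd ℂ) (n y)) x = (starRingEnd ℂ) (primitive n x) := by
  rw [primitive, primitive]
  exact integral_conj

theorem integrable_conj {n : ℝ → ℂ} (hn : Integrable n) :
    Integrable (fun y => (starRingEnd ℂ) (n y)) :=
  (LinearIsometryEquiv.integrable_comp_iff Complex.conjLIE).2 hn

/-- If `f = c + ∫_{-∞}^x n`, then `|f(∞)|² = |c|² + 2 Re ∫ f̄ n`. -/
theorem normSq_add_integral {n : ℝ → ℂ} (hn : Integrable n) (c : ℂ) :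
    ‖c + ∫ x, n x‖ ^ 2 =
      ‖c‖ ^ 2 + 2 * (∫ x, (starRingEnd ℂ) (c + primitive n x) * n x).re := by
  have hnc := integrable_conj hn
  have h1 := integral_mul_primitive hn hnc
  have e1 : ∫ x, n x * primitive (fun y => (starRingEnd ℂ) (n y)) x =
      ∫ x, (starRingEnd ℂ) (primitive n x) * n x := by
    congr 1; funext x; rw [primitive_conj, mul_comm]
  have e2 : ∫ y, (starRingEnd ℂ) (n y) * primitive n y =
      (starRingEnd ℂ) (∫ x, (starRingEnd ℂ) (primitive n x) * n x) := by
    rw [← integral_conj_eq]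
    congr 1; funext x; simp [mul_comm]
  rw [e1, e2, integral_conj_eq] at h1
  have h2 : ∫ x, (starRingEnd ℂ) (c + primitive n x) * n x =
      (starRingEnd ℂ) c * (∫ x, n x) + ∫ x, (starRingEnd ℂ) (primitive n x) * n x := by
    rw [← integral_const_mul, ← integral_add (hn.const_mul _)]
    · congr 1; funext x; simp [add_mul]
    · have := integrable_mul_primitive hn hnc
      refine this.congr (Eventually.of_forall fun x => ?_)
      simp only [primitive_conj, mul_comm]
  rw [h2]
  have h3 := congrArg Complex.re h1
  simp only [Complex.mul_re, Complex.sub_re, Complex.conj_re, Complex.conj_im] at h3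
  simp only [Complex.sq_norm, Complex.normSq_apply, Complex.add_re, Complex.add_im, Complex.mul_re,
    Complex.conj_re, Complex.conj_im]
  nlinarith [h3]

/-- If `f = c + ∫_{-∞}^x n`, then `|f|² = |c|² + ∫_{-∞}^x 2 Re (f̄ n)`. -/
theorem normSq_add_primitive {n : ℝ → ℂ} (hn : Integrable n) (c : ℂ) (X : ℝ) :
    ‖c + primitive n X‖ ^ 2 =
      ‖c‖ ^ 2 + 2 * (primitive (fun x => (starRingEnd ℂ) (c + primitive n x) * n x) X).re := by
  -- Truncating `n` to `(-∞, X]` turns the value at `X` into a value at `+∞`.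
  have h := normSq_add_integral (hn.indicator (measurableSet_Iic (a := X))) c
  rw [integral_indicator measurableSet_Iic] at h
  rw [primitive, h, primitive, ← integral_indicator measurableSet_Iic]
  congr 4; funext x
  by_cases hx : x ≤ X
  · simp [primitive_indicator_Iic, hx]
  · simp [hx]

theorem primitive_deriv {φ φ' : ℝ → ℂ} (h : ∀ x, HasDerivAt φ (φ' x) x) (hi : Integrable φ')
    (h0 : Tendsto φ atBot (𝓝 0)) (x : ℝ) : primitive φ' x = φ x := by
  rw [primitive, integral_Iic_of_hasDerivAt_of_tendsto' (fun x _ => h x) hi.integrableOn h0,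
    sub_zero]

theorem _root_.SchwartzMap.tendsto_atBot_zero (φ : 𝓢(ℝ, ℂ)) : Tendsto φ atBot (𝓝 0) :=
  (φ.toZeroAtInfty.zero_at_infty').mono_left _root_.atBot_le_cocompact

theorem _root_.SchwartzMap.tendsto_atTop_zero (φ : 𝓢(ℝ, ℂ)) : Tendsto φ atTop (𝓝 0) :=
  (φ.toZeroAtInfty.zero_at_infty').mono_left _root_.atTop_le_cocompact

theorem _root_.SchwartzMap.integrable_deriv (φ : 𝓢(ℝ, ℂ)) : Integrable (deriv φ) :=
  (SchwartzMap.derivCLM ℂ ℂ φ).integrable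

theorem primitive_deriv_schwartz (φ : 𝓢(ℝ, ℂ)) (x : ℝ) : primitive (deriv φ) x = φ x :=
  primitive_deriv φ.hasDerivAt φ.integrable_deriv φ.tendsto_atBot_zero x

theorem integral_deriv_schwartz (φ : 𝓢(ℝ, ℂ)) : ∫ x, deriv φ x = 0 := by
  refine tendsto_nhds_unique (tendsto_primitive_atTop φ.integrable_deriv) ?_
  simp_rw [funext (primitive_deriv_schwartz φ)]
  exact φ.tendsto_atTop_zero

/-- The distributional derivative of a primitive. -/
theorem integral_deriv_mul_primitive (φ : 𝓢(ℝ, ℂ)) {n : ℝ → ℂ} (hn : Integrable n) :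
    ∫ x, deriv φ x * primitive n x = - ∫ x, n x * φ x := by
  rw [integral_mul_primitive φ.integrable_deriv hn, integral_deriv_schwartz]
  simp [primitive_deriv_schwartz]

/-! ### The Hardy condition by duality, and operations that preserve it -/

/-- A function whose distributional Fourier transform vanishes on `(-∞, 0)`. -/
def IsHardy (f : ℝ → ℂ) : Prop :=
  ∀ φ : 𝓢(ℝ, ℂ), tsupport φ ⊆ Iio 0 → ∫ x, (𝓕 φ) x * f x = 0

theorem mem_hardy_iff {p : ℝ≥0∞} [Fact (1 ≤ p)] (f : Lp ℂ p (volume : Measure ℝ)) :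
    f ∈ hardy p ↔ IsHardy f := by
  have h : ∀ φ : 𝓢(ℝ, ℂ), (𝓕 (Lp.toTemperedDistributionCLM ℂ volume p f) : 𝓢'(ℝ, ℂ)) φ =
      ∫ x, (𝓕 φ) x * f x := by
    intro φ
    rw [TemperedDistribution.fourier_apply, Lp.toTemperedDistributionCLM_apply,
      Lp.toTemperedDistribution_apply]
    rfl
  constructor
  · intro hf φ hφ
    rw [← h]; exact hf φ hφ
  · intro hf φ hφ
    rw [h]; exact hf φ hφ

theorem IsHardy.congr_ae {f g : ℝ → ℂ} (hf : IsHardy f) (h : f =ᵐ[volume] g) : IsHardy g := by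
  intro φ hφ
  rw [← hf φ hφ]
  refine integral_congr_ae ?_
  filter_upwards [h] with x hx
  rw [hx]

theorem fourier_schwartz_apply (φ : 𝓢(ℝ, ℂ)) (x : ℝ) :
    (𝓕 φ) x = ∫ v, Complex.exp (↑(-2 * Real.pi * v * x) * Complex.I) * φ v := by
  rw [SchwartzMap.fourier_coe, Real.fourier_real_eq_integral_exp_smul]
  rfl

theorem fourierInv_schwartz_apply (φ : 𝓢(ℝ, ℂ)) (x : ℝ) :
    (𝓕⁻ φ) x = ∫ v, Complex.exp (↑(2 * Real.pi * v * x) * Complex.I) * φ v := by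
  rw [SchwartzMap.fourierInv_coe, Real.fourierInv_eq']
  congr 1; funext v
  simp only [smul_eq_mul]
  congr 3
  simp only [RCLike.inner_apply, conj_trivial]
  push_cast; ring

theorem fourier_translate (a : ℝ) (φ : 𝓢(ℝ, ℂ)) (x : ℝ) :
    (𝓕 (SchwartzMap.compSubConstCLM ℂ a φ)) x =
      Complex.exp (↑(-2 * Real.pi * a * x) * Complex.I) * (𝓕 φ) x := by
  rw [fourier_schwartz_apply, fourier_schwartz_apply, ← integral_const_mul,
    ← integral_add_right_eq_self _ a]
  congr 1; funext v
  rw [SchwartzMap.compSubConstCLM_apply, add_sub_cancel_right, ← mul_assoc, ← Complex.exp_add]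
  congr 2
  push_cast; ring

/-- Multiplication of a Schwartz function by the character `e^{2πiaξ}`. -/
def modulate (a : ℝ) (φ : 𝓢(ℝ, ℂ)) : 𝓢(ℝ, ℂ) := 𝓕⁻ (SchwartzMap.compSubConstCLM ℂ a (𝓕 φ))

theorem fourier_modulate (a : ℝ) (φ : 𝓢(ℝ, ℂ)) (x : ℝ) :
    (𝓕 (modulate a φ)) x = (𝓕 φ) (x - a) := by
  rw [modulate, FourierTransform.fourier_fourierInv_eq, SchwartzMap.compSubConstCLM_apply]

theorem modulate_apply (a : ℝ) (φ : 𝓢(ℝ, ℂ)) (x : ℝ) :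
    modulate a φ x = Complex.exp (↑(2 * Real.pi * a * x) * Complex.I) * φ x := by
  have h : φ x = (𝓕⁻ (𝓕 φ)) x := by rw [FourierTransform.fourierInv_fourier_eq]
  rw [h, modulate, fourierInv_schwartz_apply, fourierInv_schwartz_apply, ← integral_const_mul,
    ← integral_add_right_eq_self _ a]
  congr 1; funext v
  rw [SchwartzMap.compSubConstCLM_apply, add_sub_cancel_right, ← mul_assoc, ← Complex.exp_add]
  congr 2
  push_cast; ring

theorem tsupport_modulate (a : ℝ) (φ : 𝓢(ℝ, ℂ)) : tsupport (modulate a φ) ⊆ tsupport φ := by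
  refine closure_mono fun x hx => ?_
  rw [Function.mem_support, modulate_apply] at hx
  exact right_ne_zero_of_mul hx

theorem tsupport_translate {a : ℝ} (ha : a ≤ 0) {φ : 𝓢(ℝ, ℂ)} (hφ : tsupport φ ⊆ Iio 0) :
    tsupport (SchwartzMap.compSubConstCLM ℂ a φ) ⊆ Iio 0 := by
  have h : (SchwartzMap.compSubConstCLM ℂ a φ : ℝ → ℂ) = φ ∘ (Homeomorph.subRight a) := by
    funext x
    exact SchwartzMap.compSubConstCLM_apply φ a x
  intro x hx
  rw [h, tsupport_comp_eq_preimage] at hx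
  have := hφ hx
  simp only [Homeomorph.subRight_apply, mem_Iio] at this ⊢
  linarith

/-- For `a ≤ 0` the factor raises the frequencies of `f`. On the test side it translates `φ` to the
left, which keeps its support in `(-∞, 0)`. -/
theorem IsHardy.integral_exp_mul {f : ℝ → ℂ} (hf : IsHardy f) {φ : 𝓢(ℝ, ℂ)}
    (hφ : tsupport φ ⊆ Iio 0) {a : ℝ} (ha : a ≤ 0) :
    ∫ x, (Complex.exp (↑(-2 * Real.pi * a * x) * Complex.I) * (𝓕 φ) x) * f x = 0 := by
  have := hf _ (tsupport_translate ha hφ)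
  simpa only [fourier_translate] using this

/-- Translating `𝓕 φ` multiplies `φ` by a character and does not enlarge its support; the Hardy
condition is translation invariant. -/
theorem IsHardy.translate {f : ℝ → ℂ} (hf : IsHardy f) {φ : 𝓢(ℝ, ℂ)}
    (hφ : tsupport φ ⊆ Iio 0) (a : ℝ) : ∫ x, (𝓕 φ) (x - a) * f x = 0 := by
  have := hf _ ((tsupport_modulate a φ).trans hφ)
  simpa only [fourier_modulate] using this

theorem norm_exp_ofReal_mul_I' (t : ℝ) : ‖Complex.exp (↑t * Complex.I)‖ = 1 :=
  Complex.norm_exp_ofReal_mul_I t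

theorem integral_swap_of_bounded {F : ℝ × ℝ → ℂ} (hF : Integrable F (volume.prod volume))
    {e : ℝ × ℝ → ℂ} (he : AEStronglyMeasurable e (volume.prod volume)) (hb : ∀ z, ‖e z‖ ≤ 1) :
    ∫ x : ℝ, ∫ y : ℝ, F (x, y) * e (x, y) = ∫ y : ℝ, ∫ x : ℝ, F (x, y) * e (x, y) :=
  integral_integral_swap (f := fun x y => F (x, y) * e (x, y))
    (hF.mul_bdd (c := 1) he (Eventually.of_forall hb))

theorem integral_mul_integral_swap {g k : ℝ → ℂ} (hg : Integrable g) (hk : Integrable k)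
    {e : ℝ × ℝ → ℂ} (he : Continuous e) (hb : ∀ z, ‖e z‖ ≤ 1) :
    ∫ x : ℝ, g x * ∫ ξ : ℝ, k ξ * e (x, ξ) = ∫ ξ : ℝ, k ξ * ∫ x : ℝ, e (x, ξ) * g x := by
  have h := integral_swap_of_bounded (hg.mul_prod hk) he.aestronglyMeasurable hb
  simp_rw [← integral_const_mul]
  calc _ = _ := by congr 1; funext x; congr 1; funext y; exact (mul_assoc _ _ _).symm
    _ = _ := h
    _ = _ := by congr 1; funext x; congr 1; funext y; ring

/-- Multiplication by the Fourier transform of an integrable function supported in `(-∞, 0]`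
preserves the Hardy condition. -/
theorem IsHardy.mul_fourier {f : ℝ → ℂ} (hf : IsHardy f)
    (hint : ∀ φ : 𝓢(ℝ, ℂ), Integrable (fun x => φ x * f x)) {k : ℝ → ℂ} (hk : Integrable k)
    (hk0 : ∀ ξ, 0 < ξ → k ξ = 0) :
    IsHardy (fun x =>
      (∫ ξ, k ξ * Complex.exp (↑(-2 * Real.pi * ξ * x) * Complex.I)) * f x) := by
  intro φ hφ
  have h := integral_mul_integral_swap (hint (𝓕 φ)) hk
    (e := fun z => Complex.exp (↑(-2 * Real.pi * z.2 * z.1) * Complex.I)) (by fun_prop)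
    (fun z => (norm_exp_ofReal_mul_I' _).le)
  simp only at h
  have h0 : ∀ ξ, k ξ * ∫ x : ℝ, Complex.exp (↑(-2 * Real.pi * ξ * x) * Complex.I) *
      ((𝓕 φ) x * f x) = 0 := by
    intro ξ
    rcases lt_or_ge 0 ξ with hξ | hξ
    · simp [hk0 ξ hξ]
    · have := hf.integral_exp_mul hφ hξ
      simp_rw [← mul_assoc, this, mul_zero]
  simp_rw [h0, integral_zero] at h
  rw [← h]
  congr 1; funext x; ring

theorem integrable_schwartz_mul {p : ℝ≥0∞} [hp : Fact (1 ≤ p)] (f : Lp ℂ p (volume : Measure ℝ))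
    (φ : 𝓢(ℝ, ℂ)) : Integrable (fun x => φ x * f x) := by
  have := ENNReal.HolderConjugate.inv_one_sub_inv' hp.out
  have : ENNReal.HolderConjugate (1 - p⁻¹)⁻¹ p := ENNReal.HolderConjugate.symm
  exact (φ.memLp (1 - p⁻¹)⁻¹ volume).integrable_mul (Lp.memLp f)

/-! ### The Hardy space on the Fourier side -/

theorem integral_fourier_mul (f : Lp ℂ 2 (volume : Measure ℝ)) (φ : 𝓢(ℝ, ℂ)) :
    ∫ x, (𝓕 φ) x * f x = ∫ ξ, φ ξ * (𝓕 f : Lp ℂ 2 (volume : Measure ℝ)) ξ := by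
  have h := congrArg (fun T : 𝓢'(ℝ, ℂ) => T φ) (Lp.fourier_toTemperedDistribution_eq f)
  simp only [TemperedDistribution.fourier_apply, Lp.toTemperedDistribution_apply] at h
  exact h

theorem ae_eq_zero_of_integral_schwartz {f : ℝ → ℂ} (hf : LocallyIntegrable f) {U : Set ℝ}
    (hU : IsOpen U) (h : ∀ φ : 𝓢(ℝ, ℂ), tsupport φ ⊆ U → ∫ x, φ x * f x = 0) :
    ∀ᵐ x, x ∈ U → f x = 0 := by
  refine hU.ae_eq_zero_of_integral_contDiff_smul_eq_zero (hf.locallyIntegrableOn U) ?_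
  intro g hg hgc hgU
  have h₁ : HasCompactSupport (Complex.ofRealCLM ∘ g) := hgc.comp_left rfl
  have h₂ : ContDiff ℝ ((⊤ : ℕ∞) : WithTop ℕ∞) (Complex.ofRealCLM ∘ g) := by fun_prop
  have h3 := h (h₁.toSchwartzMap h₂) ?_
  · rw [← h3]
    congr 1
  · refine subset_trans ?_ hgU
    exact closure_mono fun x hx => by
      rw [Function.mem_support] at hx ⊢
      intro h0
      apply hx
      change ((g x : ℝ) : ℂ) = 0
      rw [h0]; simp

theorem fourier_ae_eq_zero (f : Lp ℂ 2 (volume : Measure ℝ)) {U : Set ℝ} (hU : IsOpen U)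
    (h : ∀ φ : 𝓢(ℝ, ℂ), tsupport φ ⊆ U → ∫ x, (𝓕 φ) x * f x = 0) :
    ∀ᵐ ξ, ξ ∈ U → (𝓕 f : Lp ℂ 2 (volume : Measure ℝ)) ξ = 0 := by
  refine ae_eq_zero_of_integral_schwartz
    ((Lp.memLp (𝓕 f)).locallyIntegrable one_le_two) hU fun φ hφ => ?_
  rw [← integral_fourier_mul]
  exact h φ hφ

theorem mem_hardy_two_iff (f : Lp ℂ 2 (volume : Measure ℝ)) :
    f ∈ hardy 2 ↔ ∀ᵐ ξ, ξ ∈ Iio (0 : ℝ) → (𝓕 f : Lp ℂ 2 (volume : Measure ℝ)) ξ = 0 := by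
  rw [mem_hardy_iff]
  refine ⟨fun hf => fourier_ae_eq_zero f isOpen_Iio hf, fun hf φ hφ => ?_⟩
  rw [integral_fourier_mul, ← integral_zero ℝ ℂ]
  refine integral_congr_ae ?_
  filter_upwards [hf] with ξ hξ
  by_cases h : ξ ∈ Iio (0 : ℝ)
  · rw [hξ h, mul_zero]
  · rw [image_eq_zero_of_notMem_tsupport (fun h' => h (hφ h')), zero_mul]

theorem inner_eq_integral (f g : Lp ℂ 2 (volume : Measure ℝ)) :
    inner ℂ f g = ∫ x, (starRingEnd ℂ) (f x) * g x := by
  rw [L2.inner_def]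
  congr 1; funext x
  rw [RCLike.inner_apply, mul_comm]

theorem inner_eq_zero_of_fourier {f g : Lp ℂ 2 (volume : Measure ℝ)} (hf : f ∈ hardy 2)
    (hg : ∀ᵐ ξ, ξ ∈ Ioi (0 : ℝ) → (𝓕 g : Lp ℂ 2 (volume : Measure ℝ)) ξ = 0) :
    inner ℂ f g = 0 := by
  rw [← Lp.inner_fourier_eq, inner_eq_integral, ← integral_zero ℝ ℂ]
  refine integral_congr_ae ?_
  have h0 : ∀ᵐ ξ : ℝ, ξ ≠ 0 := by simp [ae_iff, measure_singleton]
  filter_upwards [(mem_hardy_two_iff f).1 hf, hg, h0] with ξ h1 h2 h3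
  rcases lt_or_gt_of_ne h3 with h | h
  · rw [h1 h]; simp
  · rw [h2 h]; simp

/-- The inverse transform of `1_{ξ>0} f̂` lies in `L²_+`. Orthogonality to it says that `1_{ξ>0} f̂`
has norm zero. -/
theorem fourier_ae_eq_zero_of_mem_orthogonal {f : Lp ℂ 2 (volume : Measure ℝ)}
    (hf : f ∈ (hardy 2)ᗮ) :
    ∀ᵐ ξ, ξ ∈ Ioi (0 : ℝ) → (𝓕 f : Lp ℂ 2 (volume : Measure ℝ)) ξ = 0 := by
  have hm : MemLp ((Ioi (0 : ℝ)).indicator (𝓕 f : Lp ℂ 2 (volume : Measure ℝ))) 2 volume :=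
    (Lp.memLp _).indicator measurableSet_Ioi
  set g : Lp ℂ 2 (volume : Measure ℝ) := hm.toLp _ with hgdef
  have hg : (g : ℝ → ℂ) =ᵐ[volume] (Ioi (0 : ℝ)).indicator (𝓕 f : Lp ℂ 2 (volume : Measure ℝ)) :=
    hm.coeFn_toLp
  have hmem : (𝓕⁻ g : Lp ℂ 2 (volume : Measure ℝ)) ∈ hardy 2 := by
    rw [mem_hardy_two_iff, FourierTransform.fourier_fourierInv_eq]
    filter_upwards [hg] with ξ h1 h2
    rw [h1, indicator_of_notMem]
    simp only [mem_Iio, mem_Ioi, not_lt] at h2 ⊢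
    exact h2.le
  have h := (Submodule.mem_orthogonal _ _).1 hf _ hmem
  rw [← Lp.inner_fourier_eq, FourierTransform.fourier_fourierInv_eq] at h
  have h2 : inner ℂ g g = inner ℂ g (𝓕 f) := by
    rw [inner_eq_integral, inner_eq_integral]
    refine integral_congr_ae ?_
    filter_upwards [hg] with ξ h1
    by_cases hξ : ξ ∈ Ioi (0 : ℝ)
    · rw [h1, indicator_of_mem hξ]
    · rw [h1, indicator_of_notMem hξ]; simp
  rw [h, inner_self_eq_zero] at h2
  rw [h2] at hg
  filter_upwards [hg, Lp.coeFn_zero ℂ 2 (volume : Measure ℝ)] with ξ h1 h0 h3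
  rw [h0, indicator_of_mem h3] at h1
  exact h1.symm

theorem szego_mem (f : Lp ℂ 2 (volume : Measure ℝ)) : szego f ∈ hardy 2 :=
  (hardy 2).starProjection_apply_mem f

theorem sub_szego_mem_orthogonal (f : Lp ℂ 2 (volume : Measure ℝ)) :
    f - szego f ∈ (hardy 2)ᗮ :=
  (hardy 2).sub_starProjection_mem_orthogonal f

theorem inner_sub_szego {f g : Lp ℂ 2 (volume : Measure ℝ)} (hg : g ∈ hardy 2) :
    inner ℂ g (f - szego f) = 0 :=
  (Submodule.mem_orthogonal _ _).1 (sub_szego_mem_orthogonal f) g hg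

/-- The function `ξ ↦ conj (φ (-ξ))`. -/
def conjReflect (φ : 𝓢(ℝ, ℂ)) : 𝓢(ℝ, ℂ) :=
  SchwartzMap.compCLMOfContinuousLinearEquiv ℝ (ContinuousLinearEquiv.neg ℝ)
    (SchwartzMap.postcompCLM (𝕜 := ℝ) (Complex.conjCLE : ℂ →L[ℝ] ℂ) φ)

theorem conjReflect_apply (φ : 𝓢(ℝ, ℂ)) (x : ℝ) :
    conjReflect φ x = (starRingEnd ℂ) (φ (-x)) := by
  simp [conjReflect]

theorem fourier_conjReflect (φ : 𝓢(ℝ, ℂ)) (x : ℝ) :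
    (𝓕 (conjReflect φ)) x = (starRingEnd ℂ) ((𝓕 φ) x) := by
  rw [fourier_schwartz_apply, fourier_schwartz_apply, ← integral_conj_eq,
    ← integral_neg_eq_self]
  congr 1; funext v
  rw [conjReflect_apply, neg_neg, map_mul, ← Complex.exp_conj]
  congr 2
  simp only [map_mul, Complex.conj_I, Complex.conj_ofReal]
  push_cast; ring

theorem tsupport_conjReflect {φ : 𝓢(ℝ, ℂ)} (hφ : tsupport φ ⊆ Ioi 0) :
    tsupport (conjReflect φ) ⊆ Iio 0 := by
  have h : tsupport (conjReflect φ) ⊆ tsupport (φ ∘ (Homeomorph.neg ℝ)) := by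
    refine closure_mono fun x hx => ?_
    rw [Function.mem_support, conjReflect_apply] at hx
    rw [Function.mem_support]
    intro h0
    apply hx
    change φ (-x) = 0 at h0
    rw [h0, map_zero]
  intro x hx
  have h1 := h hx
  rw [tsupport_comp_eq_preimage] at h1
  have := hφ h1
  simpa using this

/-- Conjugation reflects frequencies, so the test function is replaced by `conjReflect φ`, supported
on the negative side. -/
theorem fourier_star_ae_eq_zero {f : Lp ℂ 2 (volume : Measure ℝ)} (hf : f ∈ hardy 2) :
    ∀ᵐ ξ, ξ ∈ Ioi (0 : ℝ) → (𝓕 (star f) : Lp ℂ 2 (volume : Measure ℝ)) ξ = 0 := by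
  refine fourier_ae_eq_zero _ isOpen_Ioi fun φ hφ => ?_
  have h := (mem_hardy_iff f).1 hf _ (tsupport_conjReflect hφ)
  rw [← map_zero (starRingEnd ℂ), ← h, ← integral_conj_eq]
  refine integral_congr_ae ?_
  filter_upwards [Lp.coeFn_star f] with x hx
  rw [hx, fourier_conjReflect]
  simp

/-- Up to conjugation this is the inner product of `g` with `star f`, whose spectra lie on opposite
half-lines. -/
theorem integral_mul_eq_zero_of_mem_hardy {f g : Lp ℂ 2 (volume : Measure ℝ)} (hf : f ∈ hardy 2)
    (hg : g ∈ hardy 2) : ∫ x, f x * g x = 0 := by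
  have h := inner_eq_zero_of_fourier hg (fourier_star_ae_eq_zero hf)
  rw [inner_eq_integral] at h
  rw [← map_zero (starRingEnd ℂ), ← h, ← integral_conj_eq]
  refine integral_congr_ae ?_
  filter_upwards [Lp.coeFn_star f] with x hx
  rw [hx]
  simp [mul_comm]

theorem memLp_bounded_mul {p : ℝ≥0∞} {b f : ℝ → ℂ} (hf : MemLp f p volume)
    (hb : AEStronglyMeasurable b volume) {C : ℝ} (hC : ∀ x, ‖b x‖ ≤ C) :
    MemLp (fun x => b x * f x) p volume :=
  MemLp.mul (p := ∞) (q := p) (r := p) hf (memLp_top_of_bound hb C (Eventually.of_forall hC))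

/-- The product of two functions in `L²_+` satisfies the Hardy condition. -/
theorem isHardy_mul {f g : Lp ℂ 2 (volume : Measure ℝ)} (hf : f ∈ hardy 2)
    (hg : g ∈ hardy 2) : IsHardy (fun x => f x * g x) := by
  intro φ hφ
  have hb : ∀ x, ‖(𝓕 φ) x‖ ≤ ‖(𝓕 φ).toBoundedContinuousFunction‖ := fun x =>
    (𝓕 φ).toBoundedContinuousFunction.norm_coe_le_norm x
  have hm : MemLp (fun x => (𝓕 φ) x * f x) 2 volume :=
    memLp_bounded_mul (Lp.memLp f) (𝓕 φ).continuous.aestronglyMeasurable hb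
  -- The test function is itself a kernel supported in `(-∞, 0)`, so `𝓕 φ` multiplies `L²_+` into
  -- itself and can be absorbed into `f`.
  have hH : IsHardy (fun x => (𝓕 φ) x * f x) := by
    have := ((mem_hardy_iff f).1 hf).mul_fourier (integrable_schwartz_mul f) φ.integrable
      (fun ξ hξ => image_eq_zero_of_notMem_tsupport fun h => absurd (hφ h) (by simpa using hξ.le))
    convert this using 3 with x
    rw [fourier_schwartz_apply]
    congr 1; funext v
    ring
  have hmem : hm.toLp _ ∈ hardy 2 := (mem_hardy_iff _).2 (hH.congr_ae hm.coeFn_toLp.symm)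
  rw [← integral_mul_eq_zero_of_mem_hardy hmem hg]
  refine integral_congr_ae ?_
  filter_upwards [hm.coeFn_toLp] with x hx
  rw [hx]; ring

/-- By Fourier inversion the pairing equals `φ(λ/2π)`, a value outside the support of `φ`. -/
theorem isHardy_exp {lam : ℝ} (hlam : 0 ≤ lam) :
    IsHardy (fun x => Complex.exp (Complex.I * lam * x)) := by
  intro φ hφ
  have h : φ (lam / (2 * Real.pi)) = (𝓕⁻ (𝓕 φ)) (lam / (2 * Real.pi)) := by
    rw [FourierTransform.fourierInv_fourier_eq]
  rw [fourierInv_schwartz_apply, image_eq_zero_of_notMem_tsupport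
    (fun h' => absurd (hφ h') (by simp only [mem_Iio, not_lt]; positivity))] at h
  rw [h]
  congr 1; funext x
  rw [mul_comm]
  congr 2
  have : (Real.pi : ℂ) ≠ 0 := by exact_mod_cast Real.pi_ne_zero
  push_cast; field_simp

/-- The outgoing solution of `(D - λ) m = -i G` is in the Hardy class if `G` is. -/
theorem IsHardy.exp_mul_primitive {G : ℝ → ℂ} (hG : IsHardy G) (hi : Integrable G) (lam : ℝ) :
    IsHardy (fun x => Complex.exp (Complex.I * lam * x) *
      primitive (fun y => Complex.exp (-(Complex.I * lam * y)) * G y) x) := by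
  intro φ hφ
  set a : ℝ → ℂ := fun x => (𝓕 φ) x * Complex.exp (Complex.I * lam * x) with ha_def
  set b : ℝ → ℂ := fun y => G y * Complex.exp (-(Complex.I * lam * y)) with hb_def
  have hnorm : ∀ x : ℝ, ‖Complex.exp (Complex.I * lam * x)‖ ≤ 1 := fun x => by
    rw [show Complex.I * lam * x = ((lam * x : ℝ) : ℂ) * Complex.I by push_cast; ring]
    exact (norm_exp_ofReal_mul_I' _).le
  have hnorm' : ∀ x : ℝ, ‖Complex.exp (-(Complex.I * lam * x))‖ ≤ 1 := fun x => by
    rw [show -(Complex.I * lam * x) = ((-(lam * x) : ℝ) : ℂ) * Complex.I by push_cast; ring]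
    exact (norm_exp_ofReal_mul_I' _).le
  have ha : Integrable a := integrable_mul_of_bounded (𝓕 φ).integrable
    (Continuous.aestronglyMeasurable (by fun_prop)) hnorm
  have hb : Integrable b := integrable_mul_of_bounded hi
    (Continuous.aestronglyMeasurable (by fun_prop)) hnorm'
  have hprod : Integrable (fun z : ℝ × ℝ => G z.1 * (𝓕 φ) (z.1 + z.2)) (volume.prod volume) :=
    (measurePreserving_prod_add volume volume).integrable_comp_of_integrable
      (hi.mul_prod (𝓕 φ).integrable)
  -- With `x = y + t`, `t > 0`, the two exponentials combine to `e^{iλt}`. For fixed `t` the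
  -- `y`-integral then pairs `G` with a translate of `𝓕 φ`, and so vanishes.
  have h1 : ∀ y, b y * ∫ x in Ioi y, a x = ∫ t : ℝ, (G y * (𝓕 φ) (y + t)) *
      (Ioi (0 : ℝ)).indicator (fun t => Complex.exp (Complex.I * lam * t)) t := by
    intro y
    rw [← integral_indicator measurableSet_Ioi, ← integral_add_right_eq_self _ y,
      ← integral_const_mul]
    congr 1; funext t
    by_cases ht : 0 < t
    · rw [indicator_of_mem (by simpa using ht), indicator_of_mem (by simpa using ht)]
      simp only [ha_def, hb_def]
      have he : Complex.exp (Complex.I * lam * t) = Complex.exp (-(Complex.I * lam * y)) *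
          Complex.exp (Complex.I * lam * ↑(t + y)) := by
        rw [← Complex.exp_add]; congr 1; push_cast; ring
      rw [he, add_comm t y]; ring
    · rw [indicator_of_notMem (by simpa using ht), indicator_of_notMem (by simpa using ht)]
      simp
  have h0 : ∀ t, ∫ y : ℝ, (G y * (𝓕 φ) (y + t)) *
      (Ioi (0 : ℝ)).indicator (fun t => Complex.exp (Complex.I * lam * t)) t = 0 := by
    intro t
    rw [integral_mul_const]
    have := hG.translate hφ (-t)
    simp only [sub_neg_eq_add] at this
    simp_rw [mul_comm (G _), this, zero_mul]
  calc ∫ x : ℝ, (𝓕 φ) x * (Complex.exp (Complex.I * lam * x) *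
        primitive (fun y => Complex.exp (-(Complex.I * lam * y)) * G y) x)
      = ∫ x : ℝ, a x * primitive b x := by
        simp_rw [ha_def, hb_def, mul_comm (G _), mul_assoc]
    _ = ∫ y : ℝ, b y * ∫ x in Ioi y, a x := by
        rw [integral_mul_primitive ha hb, mul_comm, ← integral_mul_const,
          ← integral_sub (hb.mul_const _) (integrable_mul_primitive hb ha)]
        congr 1; funext y
        rw [← primitive_add_integral_Ioi ha y]; ring
    _ = ∫ y : ℝ, ∫ t : ℝ, (G y * (𝓕 φ) (y + t)) *
          (Ioi (0 : ℝ)).indicator (fun t => Complex.exp (Complex.I * lam * t)) t := by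
        simp_rw [h1]
    _ = ∫ t : ℝ, ∫ y : ℝ, (G y * (𝓕 φ) (y + t)) *
          (Ioi (0 : ℝ)).indicator (fun t => Complex.exp (Complex.I * lam * t)) t :=
        integral_swap_of_bounded hprod (e := fun z => (Ioi (0 : ℝ)).indicator
          (fun t : ℝ => Complex.exp (Complex.I * lam * t)) z.2)
          ((Measurable.indicator (by fun_prop) measurableSet_Ioi).comp
            measurable_snd).aestronglyMeasurable
          (fun z => (norm_indicator_le_norm_self _ _).trans (hnorm _))
    _ = 0 := by simp_rw [h0, integral_zero]

/-! ### Bounded analytic multipliers -/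

/-- The function `1 / (1 - iεx)`. -/
def resolventFun (ε x : ℝ) : ℂ := 1 / (1 - Complex.I * ε * x)

theorem one_sub_I_mul_ne_zero (ε x : ℝ) : (1 - Complex.I * ε * x : ℂ) ≠ 0 := by
  intro h
  have := congrArg Complex.re h
  simp at this

theorem one_le_norm_one_sub_I_mul (ε x : ℝ) : 1 ≤ ‖(1 - Complex.I * ε * x : ℂ)‖ := by
  have := Complex.abs_re_le_norm (1 - Complex.I * ε * x : ℂ)
  simpa using this

theorem norm_resolventFun_le (ε x : ℝ) : ‖resolventFun ε x‖ ≤ 1 := by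
  rw [resolventFun, norm_div, norm_one]
  exact div_le_one_of_le₀ (one_le_norm_one_sub_I_mul ε x) (norm_nonneg _)

theorem continuous_resolventFun (ε : ℝ) : Continuous (resolventFun ε) :=
  continuous_const.div (by fun_prop) (one_sub_I_mul_ne_zero ε)

/-- A one-sided exponential supported in `(-∞, 0]` has this Fourier transform; it is the kernel to
which `IsHardy.mul_fourier` is applied. -/
theorem resolventFun_eq_integral {ε : ℝ} (hε : 0 < ε) (x : ℝ) :
    ∫ ξ, (Iic (0 : ℝ)).indicator (fun ξ : ℝ =>
        (2 * Real.pi / ε : ℂ) * Complex.exp ((2 * Real.pi / ε : ℂ) * ξ)) ξ *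
      Complex.exp (↑(-2 * Real.pi * ξ * x) * Complex.I) = resolventFun ε x := by
  have hε' : (ε : ℂ) ≠ 0 := by exact_mod_cast hε.ne'
  have hpi : (Real.pi : ℂ) ≠ 0 := by exact_mod_cast Real.pi_ne_zero
  have h1 := one_sub_I_mul_ne_zero ε x
  set a : ℂ := 2 * Real.pi / ε * (1 - Complex.I * ε * x) with ha_def
  have ha : a = (2 * Real.pi / ε : ℂ) + ↑(-2 * Real.pi * x) * Complex.I := by
    rw [ha_def]; push_cast; field_simp; ring
  have hre : 0 < a.re := by
    rw [ha, show (2 * Real.pi / ε : ℂ) = ((2 * Real.pi / ε : ℝ) : ℂ) by push_cast; rfl,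
      Complex.add_re, Complex.ofReal_re, Complex.re_ofReal_mul, Complex.I_re]
    have := Real.pi_pos
    simp only [mul_zero, add_zero]
    positivity
  calc _ = ∫ ξ, (Iic (0 : ℝ)).indicator (fun ξ : ℝ =>
        (2 * Real.pi / ε : ℂ) * Complex.exp (a * ξ)) ξ := by
        congr 1; funext ξ
        by_cases h : ξ ∈ Iic (0 : ℝ)
        · rw [indicator_of_mem h, indicator_of_mem h, mul_assoc, ← Complex.exp_add, ha]
          congr 2
          push_cast; ring
        · rw [indicator_of_notMem h, indicator_of_notMem h, zero_mul]
    _ = (2 * Real.pi / ε : ℂ) * (Complex.exp (a * (0 : ℝ)) / a) := by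
        rw [integral_indicator measurableSet_Iic, integral_const_mul,
          integral_exp_mul_complex_Iic hre]
    _ = _ := by
        rw [resolventFun, ha_def]
        simp only [Complex.ofReal_zero, mul_zero, Complex.exp_zero]
        field_simp

theorem IsHardy.resolventFun_mul {f : ℝ → ℂ} (hf : IsHardy f)
    (hint : ∀ φ : 𝓢(ℝ, ℂ), Integrable (fun x => φ x * f x)) {ε : ℝ} (hε : 0 < ε) :
    IsHardy (fun x => resolventFun ε x * f x) := by
  have hk : Integrable ((Iic (0 : ℝ)).indicator (fun ξ : ℝ =>
        (2 * Real.pi / ε : ℂ) * Complex.exp ((2 * Real.pi / ε : ℂ) * ξ))) := by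
    refine IntegrableOn.integrable_indicator ?_ measurableSet_Iic
    refine Integrable.const_mul (integrableOn_exp_mul_complex_Iic ?_ 0) _
    rw [show (2 * Real.pi / ε : ℂ) = ((2 * Real.pi / ε : ℝ) : ℂ) by push_cast; rfl,
      Complex.ofReal_re]
    have := Real.pi_pos
    positivity
  have := hf.mul_fourier hint hk (fun ξ hξ => indicator_of_notMem (by simpa using hξ) _)
  simpa only [resolventFun_eq_integral hε] using this

theorem integrable_schwartz_mul_memLp {f : ℝ → ℂ} (hf : MemLp f 2 volume) (φ : 𝓢(ℝ, ℂ)) :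
    Integrable (fun x => φ x * f x) :=
  (φ.memLp 2 volume).integrable_mul hf

theorem memLp_resolventFun_pow_mul {f : ℝ → ℂ} (hf : MemLp f 2 volume) (ε : ℝ) (n : ℕ) :
    MemLp (fun x => resolventFun ε x ^ n * f x) 2 volume :=
  memLp_bounded_mul hf ((continuous_resolventFun ε).pow n).aestronglyMeasurable (C := 1) fun x => by
    rw [norm_pow]; exact pow_le_one₀ (norm_nonneg _) (norm_resolventFun_le ε x)

theorem IsHardy.resolventFun_pow_mul {f : ℝ → ℂ} (hf : IsHardy f) (hf2 : MemLp f 2 volume)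
    {ε : ℝ} (hε : 0 < ε) (n : ℕ) : IsHardy (fun x => resolventFun ε x ^ n * f x) := by
  induction n with
  | zero => simpa using hf
  | succ n ih =>
    have := ih.resolventFun_mul
      (integrable_schwartz_mul_memLp (memLp_resolventFun_pow_mul hf2 ε n)) hε
    simpa only [pow_succ', mul_assoc] using this

/-- Multiplication by an absolutely convergent power series in `1 / (1 - iεx)` preserves `L²_+`. -/
theorem IsHardy.tsum_mul {f : ℝ → ℂ} (hf : IsHardy f) (hf2 : MemLp f 2 volume)
    {ε : ℝ} (hε : 0 < ε) {c : ℕ → ℂ} (hc : Summable fun n => ‖c n‖) :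
    IsHardy (fun x => (∑' n, c n * resolventFun ε x ^ n) * f x) := by
  intro φ hφ
  have hint : ∀ n, Integrable (fun x => (𝓕 φ) x * (resolventFun ε x ^ n * f x)) := fun n =>
    integrable_schwartz_mul_memLp (memLp_resolventFun_pow_mul hf2 ε n) (𝓕 φ)
  have hsum : Summable fun n => ∫ x, ‖c n * ((𝓕 φ) x * (resolventFun ε x ^ n * f x))‖ := by
    refine Summable.of_nonneg_of_le (fun n => integral_nonneg fun x => norm_nonneg _)
      (fun n => ?_) (hc.mul_right (∫ x, ‖(𝓕 φ) x * f x‖))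
    rw [← integral_const_mul]
    refine integral_mono ((hint n).const_mul _).norm
      ((integrable_schwartz_mul_memLp hf2 (𝓕 φ)).norm.const_mul _) fun x => ?_
    simp only [norm_mul, norm_pow]
    have h1 : ‖resolventFun ε x‖ ^ n ≤ 1 := pow_le_one₀ (norm_nonneg _) (norm_resolventFun_le ε x)
    gcongr
    exact mul_le_of_le_one_left (norm_nonneg _) h1
  have h := hasSum_integral_of_summable_integral_norm (fun n => (hint n).const_mul (c n)) hsum
  have h0 : ∀ n, ∫ x, c n * ((𝓕 φ) x * (resolventFun ε x ^ n * f x)) = 0 := fun n => by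
    rw [integral_const_mul, hf.resolventFun_pow_mul hf2 hε n φ hφ, mul_zero]
  simp_rw [h0] at h
  rw [← h.unique hasSum_zero]
  congr 1; funext x
  beta_reduce
  rw [← tsum_mul_right, ← tsum_mul_left]
  congr 1; funext n; ring

/-- The bounded outer function `((1 - ix) / (1 - iεx))^s`, up to a constant factor. -/
def outerWeight (s ε x : ℝ) : ℂ := (1 - (1 - ε) * resolventFun ε x) ^ (s : ℂ)

theorem one_sub_mul_resolventFun (ε x : ℝ) :
    1 - (1 - ε) * resolventFun ε x =
      ε * ((1 - Complex.I * x) / (1 - Complex.I * ε * x)) := by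
  have := one_sub_I_mul_ne_zero ε x
  rw [resolventFun, mul_one_div, one_sub_div this, mul_div_assoc']
  congr 1; ring

/-- The real part has the sign of `Re ((1 - ix)(1 + iεx)) = 1 + εx²`. Values in the right half-plane
make the principal power continuous and bound its argument. -/
theorem re_one_sub_mul_resolventFun_pos {ε : ℝ} (hε : 0 < ε) (x : ℝ) :
    0 < (1 - (1 - ε) * resolventFun ε x : ℂ).re := by
  rw [one_sub_mul_resolventFun, Complex.re_ofReal_mul, Complex.div_re]
  have h : 0 < Complex.normSq (1 - Complex.I * ε * x) :=
    Complex.normSq_pos.2 (one_sub_I_mul_ne_zero ε x)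
  rw [← add_div]
  refine mul_pos hε (div_pos ?_ h)
  simp
  nlinarith [mul_nonneg hε.le (mul_self_nonneg x)]

theorem norm_one_sub_I_mul_sq (a : ℝ) : ‖(1 - Complex.I * a : ℂ)‖ ^ 2 = 1 + a ^ 2 := by
  rw [Complex.sq_norm, Complex.normSq_apply]; simp; ring

theorem norm_outerWeight {s ε : ℝ} (hε : 0 < ε) (x : ℝ) :
    ‖outerWeight s ε x‖ = ε ^ s * (((1 + x ^ 2) / (1 + (ε * x) ^ 2)) ^ (s / 2)) := by
  rw [outerWeight, Complex.norm_cpow_real, one_sub_mul_resolventFun, norm_mul, Complex.norm_real,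
    Real.norm_of_nonneg hε.le, Real.mul_rpow hε.le (norm_nonneg _)]
  congr 1
  rw [norm_div, ← norm_one_sub_I_mul_sq, ← norm_one_sub_I_mul_sq, ← div_pow,
    ← Real.rpow_natCast, ← Real.rpow_mul (by positivity)]
  congr 1
  · push_cast; rw [mul_assoc]
  · push_cast; ring

/-- Since `|resolventFun| ≤ 1` and `1 - ε < 1`, the binomial series is evaluated in a disc of radius
`1 - ε`, strictly inside its disc of convergence. This is why the weight is normalized as a power of
`1 - (1 - ε) · resolventFun`. -/
theorem outerWeight_eq_tsum {s ε : ℝ} (hε : 0 < ε) (hε1 : ε < 1) :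
    ∃ c : ℕ → ℂ, (Summable fun n => ‖c n‖) ∧
      ∀ x, outerWeight s ε x = ∑' n, c n * resolventFun ε x ^ n := by
  have hP := Complex.one_add_cpow_hasFPowerSeriesOnBall_zero (a := (s : ℂ))
  set P := binomialSeries ℂ (s : ℂ)
  refine ⟨fun n => (-(1 - ε : ℂ)) ^ n * P.coeff n, ?_, fun x => ?_⟩
  · have h1 : (((1 - ε).toNNReal : NNReal) : ℝ≥0∞) < P.radius := by
      refine lt_of_lt_of_le ?_ hP.r_le
      rw [← ENNReal.coe_one, ENNReal.coe_lt_coe, Real.toNNReal_lt_one]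
      linarith
    have h2 := P.summable_norm_mul_pow h1
    refine h2.congr fun n => ?_
    rw [norm_mul, norm_pow, norm_neg, FormalMultilinearSeries.norm_apply_eq_norm_coef, mul_comm]
    congr 2
    rw [show (1 - ε : ℂ) = ((1 - ε : ℝ) : ℂ) by push_cast; rfl, Complex.norm_real,
      Real.norm_of_nonneg (by linarith), Real.coe_toNNReal _ (by linarith)]
  · have hmem : -((1 - ε) * resolventFun ε x : ℂ) ∈ Metric.eball (0 : ℂ) 1 := by
      rw [Metric.mem_eball, edist_zero_right, enorm_neg, ← ofReal_norm, ENNReal.ofReal_lt_one,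
        norm_mul, show (1 - ε : ℂ) = ((1 - ε : ℝ) : ℂ) by push_cast; rfl, Complex.norm_real,
        Real.norm_of_nonneg (by linarith)]
      have := norm_resolventFun_le ε x
      nlinarith [norm_nonneg (resolventFun ε x)]
    have h := hP.hasSum hmem
    simp only [zero_add, FormalMultilinearSeries.apply_eq_pow_smul_coeff, smul_eq_mul] at h
    rw [outerWeight, sub_eq_add_neg, ← h.tsum_eq]
    congr 1; funext n
    rw [← neg_mul, mul_pow]; ring

theorem continuous_outerWeight {s ε : ℝ} (hε : 0 < ε) : Continuous (outerWeight s ε) := by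
  refine Continuous.cpow (by have := continuous_resolventFun ε; fun_prop) continuous_const
    fun x => Or.inl (re_one_sub_mul_resolventFun_pos hε x)

theorem IsHardy.outerWeight_mul {f : ℝ → ℂ} (hf : IsHardy f) (hf2 : MemLp f 2 volume)
    {s ε : ℝ} (hε : 0 < ε) (hε1 : ε < 1) : IsHardy (fun x => outerWeight s ε x * f x) := by
  obtain ⟨c, hc, h⟩ := outerWeight_eq_tsum (s := s) hε hε1
  simp_rw [h]
  exact hf.tsum_mul hf2 hε hc

theorem outerWeight_bounded {s ε : ℝ} (hε : 0 < ε) (hε1 : ε < 1) :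
    ∃ C, ∀ x, ‖outerWeight s ε x‖ ≤ C := by
  obtain ⟨c, hc, h⟩ := outerWeight_eq_tsum (s := s) hε hε1
  refine ⟨∑' n, ‖c n‖, fun x => ?_⟩
  have hle : ∀ n, ‖c n * resolventFun ε x ^ n‖ ≤ ‖c n‖ := fun n => by
    rw [norm_mul, norm_pow]
    exact mul_le_of_le_one_right (norm_nonneg _)
      (pow_le_one₀ (norm_nonneg _) (norm_resolventFun_le ε x))
  rw [h]
  exact tsum_of_norm_bounded hc.hasSum hle

/-- The squared weight has argument `2s · arg z` with `|arg z| < π/2`, so it stays in the sector of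
half-angle `πs < π/2`. -/
theorem re_outerWeight_sq {s ε : ℝ} (hs : 0 ≤ s) (hs1 : s < 1 / 2) (hε : 0 < ε) (x : ℝ) :
    Real.cos (Real.pi * s) * ‖outerWeight s ε x‖ ^ 2 ≤ (outerWeight s ε x ^ 2).re := by
  set z : ℂ := 1 - (1 - ε) * resolventFun ε x with hz
  have hre : 0 < z.re := re_one_sub_mul_resolventFun_pos hε x
  have hz0 : z ≠ 0 := fun h => by rw [h] at hre; simp at hre
  have harg : |z.arg| < Real.pi / 2 := Complex.abs_arg_lt_pi_div_two_iff.2 (Or.inl hre)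
  have hw : outerWeight s ε x ^ 2 = Complex.exp (Complex.log z * (2 * s : ℝ)) := by
    rw [outerWeight, ← hz, Complex.cpow_def_of_ne_zero hz0, ← Complex.exp_nat_mul]
    congr 1; push_cast; ring
  have hn : ‖outerWeight s ε x‖ ^ 2 = Real.exp ((Complex.log z * (2 * s : ℝ)).re) := by
    rw [← norm_pow, hw, Complex.norm_exp]
  rw [hn, hw, Complex.exp_re, mul_comm, Complex.im_mul_ofReal, Complex.log_im]
  refine mul_le_mul_of_nonneg_left ?_ (Real.exp_pos _).le
  rw [← Real.cos_abs (z.arg * _), abs_mul, abs_of_nonneg (by positivity : (0:ℝ) ≤ 2 * s)]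
  have hpi := Real.pi_pos
  refine Real.cos_le_cos_of_nonneg_of_le_pi (by positivity) (by nlinarith) ?_
  nlinarith [abs_nonneg z.arg]

/-! ### Weighted bounds for the Szegő projector -/

/-- The cross term of the square is `|w|² h̄ q`. Subtracting `k w̄² h̄ q`, which will integrate to
zero, leaves the coefficient `w - k w̄`, and the sector condition gives `|w - k w̄|² ≤ (1 + k² -
2k²)|w|² = (1 - k²)|w|²`. -/
theorem norm_sq_add_lower_bound {k : ℝ} (hk : 0 ≤ k) (hk1 : k ≤ 1) {w h q : ℂ}
    (hw : k * ‖w‖ ^ 2 ≤ (w ^ 2).re) :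
    (1 - √(1 - k ^ 2)) * ‖w * h‖ ^ 2 + 2 * k * ((starRingEnd ℂ) (w ^ 2 * h) * q).re ≤
      ‖w * (h + q)‖ ^ 2 := by
  set ρ := √(1 - k ^ 2) with hρ
  have hρ2 : ρ ^ 2 = 1 - k ^ 2 := Real.sq_sqrt (by nlinarith)
  have hρ0 : 0 ≤ ρ := Real.sqrt_nonneg _
  have hρ1 : ρ ≤ 1 := by nlinarith
  have h1 : ‖w - k * (starRingEnd ℂ) w‖ ≤ ρ * ‖w‖ := by
    refine abs_le_of_sq_le_sq' ?_ (by positivity) |>.2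
    rw [mul_pow, hρ2]
    rw [pow_two w] at hw
    simp only [Complex.sq_norm, Complex.normSq_apply, Complex.mul_re, Complex.sub_re,
      Complex.sub_im, Complex.mul_im, Complex.conj_re, Complex.conj_im, Complex.ofReal_re,
      Complex.ofReal_im] at hw ⊢
    nlinarith [mul_le_mul_of_nonneg_left hw hk]
  have h2 : ‖w * (h + q)‖ ^ 2 = ‖w * h‖ ^ 2 + ‖w * q‖ ^ 2 +
      2 * ((starRingEnd ℂ) (w * h) * (w * q)).re := by
    rw [mul_add]
    simp only [Complex.sq_norm, Complex.normSq_apply, Complex.add_re, Complex.add_im,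
      Complex.mul_re, Complex.conj_re, Complex.conj_im]
    ring
  have h3 : (starRingEnd ℂ) (w * h) * (w * q) = k * ((starRingEnd ℂ) (w ^ 2 * h) * q) +
      (w - k * (starRingEnd ℂ) w) * ((starRingEnd ℂ) (w * h) * q) := by
    simp only [map_mul, map_pow]; ring
  have h4 : -(ρ * (‖w * h‖ * ‖w * q‖)) ≤
      ((w - k * (starRingEnd ℂ) w) * ((starRingEnd ℂ) (w * h) * q)).re := by
    refine (abs_le.1 ((Complex.abs_re_le_norm _).trans ?_)).1
    rw [norm_mul, norm_mul, RCLike.norm_conj, norm_mul w q]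
    calc _ ≤ ρ * ‖w‖ * (‖w * h‖ * ‖q‖) := by gcongr
      _ = _ := by ring
  rw [h2, h3, Complex.add_re, Complex.re_ofReal_mul]
  nlinarith [sq_nonneg (‖w * h‖ - ‖w * q‖), mul_nonneg hρ0 (sq_nonneg (‖w * h‖ - ‖w * q‖)),
    mul_nonneg (sub_nonneg.2 hρ1) (sq_nonneg ‖w * q‖)]

theorem integrable_norm_sq_bounded_mul (f : Lp ℂ 2 (volume : Measure ℝ)) {b : ℝ → ℂ}
    (hb : Continuous b) {C : ℝ} (hC : ∀ x, ‖b x‖ ≤ C) :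
    Integrable (fun x => ‖b x * f x‖ ^ 2) :=
  (memLp_two_iff_integrable_sq_norm (hb.aestronglyMeasurable.mul (Lp.aestronglyMeasurable f))).1
    (memLp_bounded_mul (Lp.memLp f) hb.aestronglyMeasurable hC)

/-- The Helson–Szegő inequality for the weights `|outerWeight s ε|²`, uniformly in `ε`. -/
theorem szego_outerWeight {s ε : ℝ} (hs : 0 ≤ s) (hs1 : s < 1 / 2) (hε : 0 < ε) (hε1 : ε < 1)
    (p : Lp ℂ 2 (volume : Measure ℝ)) :
    (1 - √(1 - Real.cos (Real.pi * s) ^ 2)) * ∫ x, ‖outerWeight s ε x * szego p x‖ ^ 2 ≤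
      ∫ x, ‖outerWeight s ε x * p x‖ ^ 2 := by
  set k := Real.cos (Real.pi * s)
  have hpi := Real.pi_pos
  have hk : 0 ≤ k := Real.cos_nonneg_of_neg_pi_div_two_le_of_le (by nlinarith) (by nlinarith)
  obtain ⟨C, hC⟩ := outerWeight_bounded (s := s) hε hε1
  have hcont := continuous_outerWeight (s := s) hε
  have hH : IsHardy (fun x => outerWeight s ε x ^ 2 * szego p x) := by
    have h1 := (((mem_hardy_iff _).1 (szego_mem p)).outerWeight_mul (s := s) (Lp.memLp _)
      hε hε1).outerWeight_mul (s := s)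
      (memLp_bounded_mul (Lp.memLp _) hcont.aestronglyMeasurable hC) hε hε1
    simpa only [pow_two, mul_assoc] using h1
  have hm : MemLp (fun x => outerWeight s ε x ^ 2 * szego p x) 2 volume :=
    memLp_bounded_mul (Lp.memLp _) (hcont.pow 2).aestronglyMeasurable (C := C ^ 2) fun x => by
      rw [norm_pow]; gcongr; exact hC x
  -- Multiplication by the squared weight keeps `Πp` in `L²_+`, hence orthogonal to `p - Πp`.
  have horth : ∫ x, (starRingEnd ℂ) (outerWeight s ε x ^ 2 * szego p x) *
      (p - szego p : Lp ℂ 2 (volume : Measure ℝ)) x = 0 := by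
    have := inner_sub_szego (f := p) ((mem_hardy_iff _).2 (hH.congr_ae hm.coeFn_toLp.symm))
    rw [inner_eq_integral] at this
    rw [← this]
    refine integral_congr_ae ?_
    filter_upwards [hm.coeFn_toLp] with x hx
    rw [hx]
  have hi : Integrable (fun x => (starRingEnd ℂ) (outerWeight s ε x ^ 2 * szego p x) *
      (p - szego p : Lp ℂ 2 (volume : Measure ℝ)) x) :=
    MemLp.integrable_mul (p := 2) (q := 2) hm.star (Lp.memLp _)
  have hre : ∫ x, ((starRingEnd ℂ) (outerWeight s ε x ^ 2 * szego p x) *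
      (p - szego p : Lp ℂ 2 (volume : Measure ℝ)) x).re = 0 := by
    have := integral_re hi
    simp only [RCLike.re_to_complex] at this
    rw [this, horth, Complex.zero_re]
  have hire : Integrable (fun x => ((starRingEnd ℂ) (outerWeight s ε x ^ 2 * szego p x) *
      (p - szego p : Lp ℂ 2 (volume : Measure ℝ)) x).re) := hi.re
  have hi1 := integrable_norm_sq_bounded_mul (szego p) hcont hC
  calc _ = ∫ x, ((1 - √(1 - k ^ 2)) * ‖outerWeight s ε x * szego p x‖ ^ 2 +
        2 * k * ((starRingEnd ℂ) (outerWeight s ε x ^ 2 * szego p x) *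
        (p - szego p : Lp ℂ 2 (volume : Measure ℝ)) x).re) := by
        rw [integral_add (hi1.const_mul _) (Integrable.const_mul hire _), integral_const_mul,
          integral_const_mul, hre, mul_zero, add_zero]
    _ ≤ _ := by
        refine integral_mono_ae ((hi1.const_mul _).add (hire.const_mul _))
          (integrable_norm_sq_bounded_mul p hcont hC) ?_
        filter_upwards [Lp.coeFn_sub p (szego p)] with x hx
        have := norm_sq_add_lower_bound hk (Real.cos_le_one _) (h := szego p x)
          (q := (p - szego p : Lp ℂ 2 (volume : Measure ℝ)) x)
          (re_outerWeight_sq hs hs1 hε x)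
        refine this.trans (le_of_eq ?_)
        rw [hx, Pi.sub_apply, add_sub_cancel]

/-- The weight `⟨x⟩^s = (1 + x²)^{s/2}`. -/
def weight (s x : ℝ) : ℝ := (1 + x ^ 2) ^ (s / 2)

theorem weight_pos (s x : ℝ) : 0 < weight s x := Real.rpow_pos_of_pos (by positivity) _

theorem weight_add (s t x : ℝ) : weight (s + t) x = weight s x * weight t x := by
  rw [weight, add_div, Real.rpow_add (by positivity)]; rfl

theorem weight_zero (x : ℝ) : weight 0 x = 1 := by simp [weight]

theorem continuous_weight (s : ℝ) : Continuous (weight s) :=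
  Continuous.rpow_const (by fun_prop) fun x => Or.inl (by positivity)

theorem eLpNorm_two_le_of_integral_le {f : ℝ → ℂ} (hf : MemLp f 2 volume) {B : ℝ}
    (h : ∫ x, ‖f x‖ ^ 2 ≤ B) : eLpNorm f 2 volume ≤ ENNReal.ofReal (B ^ (2 : ℝ)⁻¹) := by
  rw [hf.eLpNorm_eq_integral_rpow_norm two_ne_zero ENNReal.ofNat_ne_top]
  refine ENNReal.ofReal_le_ofReal ?_
  simp only [ENNReal.toReal_ofNat, Real.rpow_two]
  exact Real.rpow_le_rpow (integral_nonneg fun x => by positivity) h (by positivity)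

/-- `Π` is bounded on `L²(⟨x⟩^{2s} dx)` for `0 ≤ s < 1/2`. -/
theorem memLp_weight_szego {s : ℝ} (hs : 0 ≤ s) (hs1 : s < 1 / 2)
    (p : Lp ℂ 2 (volume : Measure ℝ)) (hp : MemLp (fun x => (weight s x : ℂ) * p x) 2 volume) :
    MemLp (fun x => (weight s x : ℂ) * szego p x) 2 volume := by
  set k := Real.cos (Real.pi * s)
  have hpi := Real.pi_pos
  have hk : 0 < k := Real.cos_pos_of_mem_Ioo ⟨by nlinarith, by nlinarith⟩
  have hc : 0 < 1 - √(1 - k ^ 2) := by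
    rw [sub_pos, Real.sqrt_lt' one_pos]; nlinarith
  set ε : ℕ → ℝ := fun n => 1 / ((n : ℝ) + 2) with hε_def
  have hε : ∀ n, 0 < ε n := fun n => by positivity
  have hε1 : ∀ n, ε n < 1 := fun n => by
    rw [hε_def]; simp only
    rw [div_lt_one (by positivity)]; linarith [(Nat.cast_nonneg n : (0 : ℝ) ≤ n)]
  have hε0 : Tendsto ε atTop (𝓝 0) := by
    have h := (tendsto_one_div_add_atTop_nhds_zero_nat (𝕜 := ℝ)).comp (tendsto_add_atTop_nat 1)
    refine h.congr fun n => ?_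
    simp only [Function.comp, hε_def]; push_cast; ring_nf
  -- The modulus of the outer weight divided by `ε^s`; it is bounded for each `n`, dominated by
  -- `⟨x⟩^s`, and converges to it. The factor `ε^s` cancels from both sides of the inequality.
  set W : ℕ → ℝ → ℝ := fun n x => ((1 + x ^ 2) / (1 + (ε n * x) ^ 2)) ^ (s / 2) with hW_def
  have hWo : ∀ n x, ‖outerWeight s (ε n) x‖ = ε n ^ s * W n x := fun n x =>
    norm_outerWeight (hε n) x
  have hεs : ∀ n, 0 < ε n ^ s := fun n => Real.rpow_pos_of_pos (hε n) _
  have hW0 : ∀ n x, 0 ≤ W n x := fun n x => by positivity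
  have hWc : ∀ n, Continuous (W n) := fun n => by
    refine Continuous.rpow_const ?_ fun x => Or.inl (by positivity)
    exact Continuous.div (by fun_prop) (by fun_prop) fun x => by positivity
  have hWle : ∀ n x, W n x ≤ weight s x := fun n x => by
    refine Real.rpow_le_rpow (by positivity) ?_ (by positivity)
    exact div_le_self (by positivity) (by nlinarith [sq_nonneg (ε n * x)])
  have hWlim : ∀ x, Tendsto (fun n => W n x) atTop (𝓝 (weight s x)) := fun x => by
    have h1 : Tendsto (fun n => (1 + x ^ 2) / (1 + (ε n * x) ^ 2)) atTop
        (𝓝 ((1 + x ^ 2) / (1 + (0 * x) ^ 2))) :=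
      tendsto_const_nhds.div (tendsto_const_nhds.add ((hε0.mul_const x).pow 2)) (by positivity)
    have h2 := h1.rpow_const (p := s / 2) (Or.inl (by positivity))
    simpa [weight] using h2
  have hpi2 : Integrable (fun x => ‖(weight s x : ℂ) * p x‖ ^ 2) :=
    (memLp_two_iff_integrable_sq_norm hp.1).1 hp
  set B := ∫ x, ‖(weight s x : ℂ) * p x‖ ^ 2
  have hbdd : ∀ n, ∃ C, ∀ x, ‖((W n x : ℝ) : ℂ)‖ ≤ C := fun n => by
    obtain ⟨C, hC⟩ := outerWeight_bounded (s := s) (hε n) (hε1 n)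
    refine ⟨C / ε n ^ s, fun x => ?_⟩
    rw [le_div_iff₀ (hεs n), Complex.norm_real, Real.norm_of_nonneg (hW0 n x), mul_comm, ← hWo]
    exact hC x
  have hmem : ∀ n, MemLp (fun x => ((W n x : ℝ) : ℂ) * szego p x) 2 volume := fun n => by
    obtain ⟨C, hC⟩ := hbdd n
    exact memLp_bounded_mul (Lp.memLp _)
      (Complex.continuous_ofReal.comp (hWc n)).aestronglyMeasurable hC
  have hbound : ∀ n, ∫ x, ‖((W n x : ℝ) : ℂ) * szego p x‖ ^ 2 ≤ B / (1 - √(1 - k ^ 2)) := by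
    intro n
    rw [le_div_iff₀ hc, mul_comm]
    have h1 := szego_outerWeight hs hs1 (hε n) (hε1 n) p
    have h2 : ∀ (f : ℝ → ℂ), ∫ x, ‖outerWeight s (ε n) x * f x‖ ^ 2 =
        (ε n ^ s) ^ 2 * ∫ x, ‖((W n x : ℝ) : ℂ) * f x‖ ^ 2 := fun f => by
      rw [← integral_const_mul]
      congr 1; funext x
      rw [norm_mul, norm_mul, hWo, Complex.norm_real, Real.norm_of_nonneg (hW0 n x)]; ring
    rw [h2, h2, mul_left_comm] at h1
    refine (le_of_mul_le_mul_left h1 (by have := hεs n; positivity)).trans ?_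
    refine integral_mono_of_nonneg (Eventually.of_forall fun x => by positivity) hpi2
      (Eventually.of_forall fun x => ?_)
    simp only [norm_mul, Complex.norm_real, Real.norm_of_nonneg (hW0 n x),
      Real.norm_of_nonneg (weight_pos s x).le]
    gcongr
    exact hWle n x
  have hlim : ∀ᵐ x : ℝ, Tendsto (fun n => ((W n x : ℝ) : ℂ) * szego p x) atTop
      (𝓝 ((weight s x : ℂ) * szego p x)) := Eventually.of_forall fun x =>
    ((Complex.continuous_ofReal.tendsto _).comp (hWlim x)).mul_const _
  refine ⟨(Complex.continuous_ofReal.comp (continuous_weight s)).aestronglyMeasurable.mul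
    (Lp.aestronglyMeasurable _), ?_⟩
  -- Fatou: the constant `1 - √(1 - k²)` does not depend on `n`.
  refine (Lp.eLpNorm_lim_le_liminf_eLpNorm (fun n => (hmem n).1) _ hlim).trans_lt ?_
  refine lt_of_le_of_lt (liminf_le_of_frequently_le' (Frequently.of_forall fun n =>
    eLpNorm_two_le_of_integral_le (hmem n) (hbound n))) ENNReal.ofReal_lt_top

/-! ### Fourier integrals -/

/-- The Fourier integral of an integrable function. -/
def fourierInt (f : ℝ → ℂ) (ξ : ℝ) : ℂ :=
  ∫ x, Complex.exp (↑(-2 * Real.pi * ξ * x) * Complex.I) * f x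

theorem continuous_fourierInt {f : ℝ → ℂ} (hf : Integrable f) : Continuous (fourierInt f) := by
  refine continuous_of_dominated (bound := fun x => ‖f x‖) (fun ξ => ?_) (fun ξ => ?_) hf.norm ?_
  · exact (Continuous.aestronglyMeasurable (by fun_prop)).mul hf.aestronglyMeasurable
  · refine Eventually.of_forall fun x => ?_
    rw [norm_mul, norm_exp_ofReal_mul_I', one_mul]
  · exact Eventually.of_forall fun x => by fun_prop

theorem fourierInt_zero (f : ℝ → ℂ) : fourierInt f 0 = ∫ x, f x := by
  simp [fourierInt]

theorem fourierInt_modulate (f : ℝ → ℂ) (a ξ : ℝ) :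
    fourierInt (fun x => Complex.exp (↑(2 * Real.pi * a * x) * Complex.I) * f x) ξ =
      fourierInt f (ξ - a) := by
  rw [fourierInt, fourierInt]
  congr 1; funext x
  rw [← mul_assoc, ← Complex.exp_add]
  congr 2; push_cast; ring

theorem integral_fourier_mul_eq (φ : 𝓢(ℝ, ℂ)) {f : ℝ → ℂ} (hf : Integrable f) :
    ∫ x, (𝓕 φ) x * f x = ∫ ξ, φ ξ * fourierInt f ξ := by
  have h := integral_mul_integral_swap hf φ.integrable
    (e := fun z => Complex.exp (↑(-2 * Real.pi * z.2 * z.1) * Complex.I)) (by fun_prop)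
    (fun z => (norm_exp_ofReal_mul_I' _).le)
  simp only at h
  calc _ = _ := by
        congr 1; funext x
        rw [fourier_schwartz_apply, mul_comm]
        congr 2; funext v; rw [mul_comm]
    _ = _ := h

theorem fourier_ae_eq_fourierInt (f : Lp ℂ 2 (volume : Measure ℝ)) (hf : Integrable f) :
    (𝓕 f : Lp ℂ 2 (volume : Measure ℝ)) =ᵐ[volume] fourierInt f := by
  have h2 : LocallyIntegrable (𝓕 f : Lp ℂ 2 (volume : Measure ℝ)) :=
    (Lp.memLp (𝓕 f)).locallyIntegrable one_le_two
  have h3 : LocallyIntegrable (fourierInt f) := (continuous_fourierInt hf).locallyIntegrable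
  have h := ae_eq_zero_of_integral_schwartz (h2.sub h3) isOpen_univ fun φ _ => ?_
  · filter_upwards [h] with ξ hξ
    exact sub_eq_zero.1 (hξ (mem_univ _))
  · obtain ⟨C, hC⟩ : ∃ C, ∀ ξ, ‖fourierInt f ξ‖ ≤ C := ⟨∫ x, ‖f x‖, fun ξ => by
      refine (norm_integral_le_integral_norm _).trans (le_of_eq ?_)
      congr 1; funext x
      rw [norm_mul, norm_exp_ofReal_mul_I', one_mul]⟩
    have i2 : Integrable (fun ξ => φ ξ * fourierInt f ξ) := integrable_mul_of_bounded φ.integrable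
      (continuous_fourierInt hf).aestronglyMeasurable hC
    simp only [Pi.sub_apply, mul_sub]
    rw [integral_sub (integrable_schwartz_mul _ φ) i2, ← integral_fourier_mul,
      ← integral_fourier_mul_eq φ hf, sub_self]

/-- The Fourier integral of `J = F'`, for `F` integrable and vanishing at infinity. -/
theorem fourierInt_eq_mul_fourierInt_primitive {J : ℝ → ℂ} (hJ : Integrable J)
    (hJ0 : ∫ x, J x = 0) (hF : Integrable (primitive J)) (η : ℝ) :
    fourierInt J η = ((2 * Real.pi * η : ℝ) * Complex.I) * fourierInt (primitive J) η := by
  set e : ℝ → ℂ := fun x => Complex.exp (↑(-2 * Real.pi * η * x) * Complex.I) with he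
  set κ : ℂ := (-2 * Real.pi * η : ℝ) * Complex.I with hκ
  have hderiv : ∀ x, HasDerivAt e (κ * e x) x := fun x => by
    have h1 : HasDerivAt (fun x : ℝ => (↑(-2 * Real.pi * η * x) * Complex.I : ℂ)) κ x := by
      have := ((hasDerivAt_id x).const_mul (-2 * Real.pi * η)).ofReal_comp.mul_const Complex.I
      simpa [hκ] using this
    rw [mul_comm]
    exact h1.cexp
  have hec : Continuous e := by rw [he]; fun_prop
  have hen : ∀ x, ‖e x‖ ≤ 1 := fun x => (norm_exp_ofReal_mul_I' _).le
  -- The character is not integrable, so it is cut to `(-R, R]` before integrating by parts. The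
  -- primitive of the cut derivative is the character frozen outside that interval, up to a constant
  -- that `∫ J = 0` removes.
  have hcut : ∀ R : ℝ, 0 ≤ R → ∫ x in Ioc (-R) R, κ * e x * primitive J x =
      - ∫ x, J x * e (max (-R) (min x R)) := by
    intro R hR
    set a : ℝ → ℂ := (Ioc (-R) R).indicator (fun x => κ * e x) with ha_def
    have ha : Integrable a := by
      refine IntegrableOn.integrable_indicator ?_ measurableSet_Ioc
      exact (Continuous.integrableOn_Icc (by fun_prop)).mono_set Ioc_subset_Icc_self
    have hprim : ∀ y, primitive a y = e (max (-R) (min y R)) - e (-R) := by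
      intro y
      rw [primitive, ha_def, setIntegral_indicator measurableSet_Ioc]
      have hset : Iic y ∩ Ioc (-R) R = Ioc (-R) (max (-R) (min y R)) := by
        ext t
        simp only [mem_inter_iff, mem_Iic, mem_Ioc, le_max_iff, le_min_iff]
        constructor
        · rintro ⟨h1, h2, h3⟩; exact ⟨h2, Or.inr ⟨h1, h3⟩⟩
        · rintro ⟨h1, h2 | h2⟩
          · exact absurd h1 (not_lt.2 h2)
          · exact ⟨h2.1, h1, h2.2⟩
      rw [hset, ← intervalIntegral.integral_of_le (le_max_left _ _),
        intervalIntegral.integral_eq_sub_of_hasDerivAt (fun x _ => hderiv x)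
          (Continuous.intervalIntegrable (by fun_prop) _ _)]
    have h := integral_mul_primitive ha hJ
    rw [hJ0, mul_zero, zero_sub] at h
    have h1 : ∫ x, a x * primitive J x = ∫ x in Ioc (-R) R, κ * e x * primitive J x := by
      rw [← integral_indicator measurableSet_Ioc]
      congr 1; funext x
      rw [ha_def]
      by_cases hx : x ∈ Ioc (-R) R
      · rw [indicator_of_mem hx, indicator_of_mem hx]
      · rw [indicator_of_notMem hx, indicator_of_notMem hx, zero_mul]
    rw [← h1, h]
    simp_rw [hprim, mul_sub]
    rw [integral_sub, integral_mul_const, hJ0, zero_mul, sub_zero]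
    · exact integrable_mul_of_bounded hJ (by fun_prop) (fun x => hen _)
    · exact hJ.mul_const _
  have hl1 : Tendsto (fun R : ℝ => ∫ x in Ioc (-R) R, κ * e x * primitive J x) atTop
      (𝓝 (∫ x, κ * e x * primitive J x)) := by
    refine (aecover_Ioc tendsto_neg_atTop_atBot tendsto_id).integral_tendsto_of_countably_generated
      ?_
    have := (integrable_mul_of_bounded hF hec.aestronglyMeasurable hen).const_mul κ
    refine this.congr (Eventually.of_forall fun x => ?_)
    simp only; ring
  have hl2 : Tendsto (fun R : ℝ => ∫ x, J x * e (max (-R) (min x R))) atTop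
      (𝓝 (∫ x, J x * e x)) := by
    refine tendsto_integral_filter_of_dominated_convergence (fun x => ‖J x‖)
      (Eventually.of_forall fun R => hJ.aestronglyMeasurable.mul
        (Continuous.aestronglyMeasurable (by fun_prop)))
      (Eventually.of_forall fun R => Eventually.of_forall fun x => ?_) hJ.norm
      (Eventually.of_forall fun x => ?_)
    · rw [norm_mul]; exact mul_le_of_le_one_right (norm_nonneg _) (hen _)
    · refine tendsto_const_nhds.congr' ?_
      filter_upwards [eventually_ge_atTop |x|] with R hR
      obtain ⟨h1, h2⟩ := abs_le.1 hR
      rw [min_eq_left h2, max_eq_right h1]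
  have hlim := tendsto_nhds_unique hl1 ((hl2.neg).congr' ((eventually_ge_atTop 0).mono
    fun R hR => (hcut R hR).symm))
  have e1 : ∫ x, J x * e x = fourierInt J η := by
    rw [fourierInt]; congr 1; funext x; rw [mul_comm]
  have e2 : ∫ x, κ * e x * primitive J x = κ * fourierInt (primitive J) η := by
    rw [fourierInt, ← integral_const_mul]; congr 1; funext x; rw [mul_assoc]
  rw [e1, e2] at hlim
  rw [← neg_eq_iff_eq_neg] at hlim
  rw [← hlim, hκ]; push_cast; ring

/-! ### The sign of the low-frequency interaction -/

theorem memLp_exp_mul (f : Lp ℂ 2 (volume : Measure ℝ)) (a : ℝ) :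
    MemLp (fun x => Complex.exp (↑(2 * Real.pi * a * x) * Complex.I) * f x) 2 volume :=
  memLp_bounded_mul (Lp.memLp f) (Continuous.aestronglyMeasurable (by fun_prop))
    fun x => (norm_exp_ofReal_mul_I' _).le

theorem fourier_exp_mul (p : Lp ℂ 2 (volume : Measure ℝ)) (hp : Integrable p) (a : ℝ) :
    (𝓕 ((memLp_exp_mul p a).toLp _) : Lp ℂ 2 (volume : Measure ℝ)) =ᵐ[volume]
      fun ξ => fourierInt p (ξ - a) := by
  have hi : Integrable ((memLp_exp_mul p a).toLp _) := by
    refine Integrable.congr ?_ (memLp_exp_mul p a).coeFn_toLp.symm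
    exact hp.bdd_mul (c := 1) (Continuous.aestronglyMeasurable (by fun_prop))
      (Eventually.of_forall fun x => (norm_exp_ofReal_mul_I' _).le)
  refine (fourier_ae_eq_fourierInt _ hi).trans (Eventually.of_forall fun ξ => ?_)
  simp only
  rw [← fourierInt_modulate]
  refine integral_congr_ae ?_
  filter_upwards [(memLp_exp_mul p a).coeFn_toLp] with x hx
  rw [hx]

theorem fourier_szego (p : Lp ℂ 2 (volume : Measure ℝ)) (hp : Integrable p) :
    (𝓕 (szego p) : Lp ℂ 2 (volume : Measure ℝ)) =ᵐ[volume]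
      (Ioi (0 : ℝ)).indicator (fourierInt p) := by
  have h0 : ∀ᵐ ξ : ℝ, ξ ≠ 0 := by simp [ae_iff, measure_singleton]
  have h1 := fourier_ae_eq_zero_of_mem_orthogonal (sub_szego_mem_orthogonal p)
  rw [show (𝓕 (p - szego p) : Lp ℂ 2 (volume : Measure ℝ)) = 𝓕 p - 𝓕 (szego p) from
    (Lp.fourierTransformₗᵢ ℝ ℂ).map_sub p (szego p)] at h1
  filter_upwards [h0, h1, (mem_hardy_two_iff _).1 (szego_mem p), fourier_ae_eq_fourierInt p hp,
    Lp.coeFn_sub (𝓕 p : Lp ℂ 2 (volume : Measure ℝ)) (𝓕 (szego p))] with ξ h0 h1 h2 h3 h4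
  by_cases h : ξ ∈ Ioi (0 : ℝ)
  · rw [indicator_of_mem h, ← h3]
    have := h1 h
    rw [h4, Pi.sub_apply, sub_eq_zero] at this
    exact this.symm
  · rw [indicator_of_notMem h]
    exact h2 (lt_of_le_of_ne (not_lt.1 h) h0)

theorem integral_exp_conj_mul_szego (p : Lp ℂ 2 (volume : Measure ℝ)) (hp : Integrable p) (η : ℝ) :
    fourierInt (fun x => (starRingEnd ℂ) (p x) * szego p x) η =
      ∫ ξ in Ioi (0 : ℝ), (starRingEnd ℂ) (fourierInt p (ξ - η)) * fourierInt p ξ := by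
  have h := inner_eq_integral ((memLp_exp_mul p η).toLp _) (szego p)
  rw [← Lp.inner_fourier_eq, inner_eq_integral] at h
  calc _ = _ := by
        refine integral_congr_ae ?_
        filter_upwards [(memLp_exp_mul p η).coeFn_toLp] with x hx
        rw [hx, map_mul, ← Complex.exp_conj, ← mul_assoc]
        congr 3
        simp only [map_mul, Complex.conj_I, Complex.conj_ofReal]
        push_cast; ring
    _ = _ := h.symm
    _ = _ := by
        rw [← integral_indicator measurableSet_Ioi]
        refine integral_congr_ae ?_
        filter_upwards [fourier_exp_mul p hp η, fourier_szego p hp] with ξ h1 h2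
        rw [h1, h2]
        by_cases h : ξ ∈ Ioi (0 : ℝ)
        · rw [indicator_of_mem h, indicator_of_mem h]
        · rw [indicator_of_notMem h, indicator_of_notMem h, mul_zero]

/-- Parseval gives an integral of `conj p̂(ξ) p̂(ξ+η)` over `ξ > 0`; the shift by `η` produces the
same integrand as in `integral_exp_conj_mul_szego`, on a different half-line. -/
theorem integral_exp_mul_conj_szego (p : Lp ℂ 2 (volume : Measure ℝ)) (hp : Integrable p) (η : ℝ) :
    fourierInt (fun x => p x * (starRingEnd ℂ) (szego p x)) η =
      ∫ ξ in Ioi η, (starRingEnd ℂ) (fourierInt p (ξ - η)) * fourierInt p ξ := by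
  have h := inner_eq_integral (szego p) ((memLp_exp_mul p (-η)).toLp _)
  rw [← Lp.inner_fourier_eq, inner_eq_integral] at h
  calc _ = _ := by
        refine integral_congr_ae ?_
        filter_upwards [(memLp_exp_mul p (-η)).coeFn_toLp] with x hx
        rw [hx, show 2 * Real.pi * -η * x = -2 * Real.pi * η * x by ring]
        ring
    _ = _ := h.symm
    _ = _ := by
        rw [← integral_indicator measurableSet_Ioi]
        conv_rhs => rw [← integral_add_right_eq_self _ η]
        refine integral_congr_ae ?_
        filter_upwards [fourier_exp_mul p hp (-η), fourier_szego p hp] with ξ h1 h2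
        rw [h1, h2]
        by_cases h : 0 < ξ
        · rw [indicator_of_mem (by simpa using h), indicator_of_mem (by simpa using h),
            add_sub_cancel_right, sub_neg_eq_add]
        · rw [indicator_of_notMem (by simpa using h), indicator_of_notMem (by simpa using h),
            map_zero, zero_mul]

/-- The two half-line integrals differ by the integral over `(0, η)`. Rescaling it to `(0, 1)`
exposes the factor `η` that cancels the one produced by differentiation. -/
theorem fourierInt_sub_eq (p : Lp ℂ 2 (volume : Measure ℝ)) (hp : Integrable p) {η : ℝ}
    (hη : 0 < η) :
    fourierInt (fun x => (starRingEnd ℂ) (p x) * szego p x) η -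
      fourierInt (fun x => p x * (starRingEnd ℂ) (szego p x)) η =
      η * ∫ t in (0 : ℝ)..1,
        (starRingEnd ℂ) (fourierInt p (η * t - η)) * fourierInt p (η * t) := by
  have hm : MemLp (fourierInt p) 2 volume :=
    (memLp_congr_ae (fourier_ae_eq_fourierInt p hp)).1 (Lp.memLp _)
  have hm' : MemLp (fun ξ => fourierInt p (ξ - η)) 2 volume :=
    hm.comp_measurePreserving (measurePreserving_sub_right volume η)
  have hi : Integrable (fun ξ => (starRingEnd ℂ) (fourierInt p (ξ - η)) * fourierInt p ξ) :=
    MemLp.integrable_mul (p := 2) (q := 2) hm'.star hm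
  rw [integral_exp_conj_mul_szego p hp, integral_exp_mul_conj_szego p hp, sub_eq_iff_eq_add,
    ← intervalIntegral.integral_interval_add_Ioi hi.integrableOn hi.integrableOn (b := η)]
  congr 1
  rw [intervalIntegral.integral_comp_mul_left
    (fun ξ => (starRingEnd ℂ) (fourierInt p (ξ - η)) * fourierInt p ξ) hη.ne']
  simp only [mul_zero, mul_one, Complex.real_smul, Complex.ofReal_inv]
  rw [mul_inv_cancel_left₀ (by exact_mod_cast hη.ne')]

/-- If `F' = -i (p̄ Πp - p conj(Πp))` with `F` integrable and `F(±∞) = 0`, then `∫ F ≤ 0`. -/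
theorem integral_primitive_eq (p : Lp ℂ 2 (volume : Measure ℝ)) (hp : Integrable p)
    {J : ℝ → ℂ} (hJ : Integrable J)
    (hJp : J =ᵐ[volume] fun x => -Complex.I * ((starRingEnd ℂ) (p x) * szego p x -
      p x * (starRingEnd ℂ) (szego p x)))
    (hJ0 : ∫ x, J x = 0) (hF : Integrable (primitive J)) :
    2 * Real.pi * ∫ x, primitive J x = -(‖∫ x, p x‖ ^ 2 : ℝ) := by
  have i1 : Integrable (fun x => (starRingEnd ℂ) (p x) * szego p x) :=
    MemLp.integrable_mul (p := 2) (q := 2) (Lp.memLp p).star (Lp.memLp _)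
  have i2 : Integrable (fun x => p x * (starRingEnd ℂ) (szego p x)) :=
    MemLp.integrable_mul (p := 2) (q := 2) (Lp.memLp p) (Lp.memLp _).star
  have key : ∀ η : ℝ, 0 < η → 2 * Real.pi * fourierInt (primitive J) η =
      - ∫ t in (0 : ℝ)..1,
        (starRingEnd ℂ) (fourierInt p (η * t - η)) * fourierInt p (η * t) := by
    intro η hη
    have h1 := fourierInt_eq_mul_fourierInt_primitive hJ hJ0 hF η
    have h2 := fourierInt_sub_eq p hp hη
    have h3 : fourierInt J η = -Complex.I *
        (fourierInt (fun x => (starRingEnd ℂ) (p x) * szego p x) η -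
          fourierInt (fun x => p x * (starRingEnd ℂ) (szego p x)) η) := by
      have hb : ∀ {f : ℝ → ℂ}, Integrable f → Integrable (fun x =>
          Complex.exp (↑(-2 * Real.pi * η * x) * Complex.I) * f x) := fun hf =>
        hf.bdd_mul (c := 1) (Continuous.aestronglyMeasurable (by fun_prop))
          (Eventually.of_forall fun x => (norm_exp_ofReal_mul_I' _).le)
      rw [fourierInt, fourierInt, fourierInt, ← integral_sub (hb i1) (hb i2),
        ← integral_const_mul]
      refine integral_congr_ae ?_
      filter_upwards [hJp] with x hx
      rw [hx]; ring
    rw [h3, h2] at h1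
    have hη' : (η : ℂ) ≠ 0 := by exact_mod_cast hη.ne'
    have hI := Complex.I_ne_zero
    refine mul_left_cancel₀ (mul_ne_zero hη' hI) ?_
    push_cast at h1
    linear_combination -h1
  -- The identity holds only for `η > 0`; its value at `0` is a limit, available because `p` and the
  -- primitive are integrable and so have continuous transforms.
  have hc := continuous_fourierInt hp
  have hQ : Continuous (fun η : ℝ => ∫ t in (0 : ℝ)..1,
        (starRingEnd ℂ) (fourierInt p (η * t - η)) * fourierInt p (η * t)) := by
    refine intervalIntegral.continuous_parametric_intervalIntegral_of_continuous' ?_ 0 1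
    simp only [Function.uncurry_def]
    exact ((Complex.continuous_conj.comp (hc.comp (by fun_prop))).mul (hc.comp (by fun_prop)))
  have l1 : Tendsto (fun η : ℝ => 2 * Real.pi * fourierInt (primitive J) η) (𝓝[>] 0)
      (𝓝 (2 * Real.pi * fourierInt (primitive J) 0)) :=
    (((continuous_fourierInt hF).tendsto 0).mono_left nhdsWithin_le_nhds).const_mul _
  have l2 : Tendsto (fun η : ℝ => - ∫ t in (0 : ℝ)..1,
        (starRingEnd ℂ) (fourierInt p (η * t - η)) * fourierInt p (η * t)) (𝓝[>] 0)
      (𝓝 (- ∫ t in (0 : ℝ)..1,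
        (starRingEnd ℂ) (fourierInt p (0 * t - 0)) * fourierInt p (0 * t))) :=
    (hQ.neg.tendsto 0).mono_left nhdsWithin_le_nhds
  have h := tendsto_nhds_unique l1 (l2.congr' (eventually_nhdsWithin_of_forall
    fun η hη => (key η hη).symm))
  rw [fourierInt_zero] at h
  rw [h]
  simp only [zero_mul, sub_zero, fourierInt_zero, intervalIntegral.integral_const, one_smul]
  rw [← Complex.normSq_eq_conj_mul_self, Complex.normSq_eq_norm_sq]

/-! ### Conservation of the modulus, decay, and uniqueness -/

/-- The right-hand side `-i w̄ h` of the equation for `f = e^{-iλx} m`. -/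
def source (w h : ℝ → ℂ) (x : ℝ) : ℂ := -Complex.I * ((starRingEnd ℂ) (w x) * h x)

theorem integrable_source (w h : Lp ℂ 2 (volume : Measure ℝ)) : Integrable (source w h) :=
  (MemLp.integrable_mul (p := 2) (q := 2) (Lp.memLp w).star (Lp.memLp h)).const_mul _

theorem norm_source (w h : ℝ → ℂ) (x : ℝ) : ‖source w h x‖ = ‖w x‖ * ‖h x‖ := by
  simp [source]

/-- `⟨p, Πp⟩ = ⟨Πp, Πp⟩`, because `p - Πp` is orthogonal to `Πp`. -/
theorem inner_szego_re_im (p : Lp ℂ 2 (volume : Measure ℝ)) :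
    (∫ x, (starRingEnd ℂ) (p x) * szego p x).im = 0 := by
  rw [← inner_eq_integral]
  have h : inner ℂ p (szego p) = inner ℂ (szego p) (szego p) := by
    have := inner_sub_szego (f := p) (szego_mem p)
    rw [inner_sub_right, sub_eq_zero] at this
    rw [← inner_conj_symm, this, inner_self_conj]
  rw [h]
  exact inner_self_im (𝕜 := ℂ) _

theorem integral_conj_mul_source {w p : Lp ℂ 2 (volume : Measure ℝ)} {c : ℂ}
    (hp : p =ᵐ[volume] fun x => w x * (c + primitive (source w (szego p)) x)) :
    (fun x => (starRingEnd ℂ) (c + primitive (source w (szego p)) x) * source w (szego p) x)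
      =ᵐ[volume] fun x => -Complex.I * ((starRingEnd ℂ) (p x) * szego p x) := by
  filter_upwards [hp] with x hx
  rw [hx, source]
  simp only [map_mul]; ring

/-- The modulus of `f` is the same at both ends. -/
theorem norm_add_integral_source {w p : Lp ℂ 2 (volume : Measure ℝ)} {c : ℂ}
    (hp : p =ᵐ[volume] fun x => w x * (c + primitive (source w (szego p)) x)) :
    ‖c + ∫ x, source w (szego p) x‖ = ‖c‖ := by
  have h := normSq_add_integral (integrable_source w (szego p)) c
  rw [integral_congr_ae (integral_conj_mul_source hp), integral_const_mul] at h
  simp only [Complex.mul_re, Complex.neg_re, Complex.I_re, Complex.neg_im, Complex.I_im,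
    inner_szego_re_im] at h
  norm_num at h
  exact h

theorem weight_mono {s : ℝ} (hs : 0 ≤ s) {x y : ℝ} (h : |x| ≤ |y|) : weight s x ≤ weight s y := by
  refine Real.rpow_le_rpow (by positivity) ?_ (by positivity)
  have := sq_le_sq.2 h
  linarith

theorem weight_le_weight {s t : ℝ} (h : s ≤ t) (x : ℝ) : weight s x ≤ weight t x :=
  Real.rpow_le_rpow_of_exponent_le (by nlinarith [sq_nonneg x]) (by linarith)

theorem memLp_weight_of_le {s t : ℝ} (h : s ≤ t) {f : ℝ → ℂ} (hfm : AEStronglyMeasurable f volume)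
    (hf : MemLp (fun x => (weight t x : ℂ) * f x) 2 volume) :
    MemLp (fun x => (weight s x : ℂ) * f x) 2 volume := by
  refine hf.of_le ((Complex.continuous_ofReal.comp
    (continuous_weight s)).aestronglyMeasurable.mul hfm) (Eventually.of_forall fun x => ?_)
  simp only [norm_mul, Complex.norm_real, Real.norm_of_nonneg (weight_pos _ x).le]
  gcongr
  exact weight_le_weight h x

/-- Decay of a primitive that vanishes at both ends. -/
theorem norm_primitive_mul_weight_le {n : ℝ → ℂ} (hn : Integrable n) (hn0 : ∫ x, n x = 0) {s : ℝ}
    (hs : 0 ≤ s) (hw : Integrable (fun x => weight s x * ‖n x‖)) (x : ℝ) :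
    ‖primitive n x‖ * weight s x ≤ ∫ y, weight s y * ‖n y‖ := by
  have hset : ∀ S : Set ℝ, MeasurableSet S → (∀ y ∈ S, |x| ≤ |y|) →
      ‖∫ y in S, n y‖ * weight s x ≤ ∫ y, weight s y * ‖n y‖ := by
    intro S hS hxy
    calc _ ≤ (∫ y in S, ‖n y‖) * weight s x := by
          gcongr
          · exact (weight_pos _ _).le
          · exact norm_integral_le_integral_norm _
      _ = ∫ y in S, weight s x * ‖n y‖ := by rw [integral_const_mul, mul_comm]
      _ ≤ ∫ y in S, weight s y * ‖n y‖ := by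
          refine setIntegral_mono_on (hn.norm.const_mul _).integrableOn hw.integrableOn hS
            fun y hy => ?_
          gcongr
          exact weight_mono hs (hxy y hy)
      _ ≤ _ := setIntegral_le_integral hw (Eventually.of_forall fun y =>
          mul_nonneg (weight_pos _ _).le (norm_nonneg _))
  -- The primitive is written as an integral over the half-line pointing away from the origin, where
  -- `|y| ≥ |x|`; for `x ≥ 0` this uses `∫ n = 0`.
  rcases le_total x 0 with hx | hx
  · refine hset _ measurableSet_Iic fun y hy => ?_
    rw [abs_of_nonpos hx, abs_of_nonpos (le_trans hy hx)]
    exact neg_le_neg hy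
  · have h : primitive n x = - ∫ y in Ioi x, n y := by
      rw [eq_neg_iff_add_eq_zero, primitive_add_integral_Ioi hn, hn0]
    rw [h, norm_neg]
    refine hset _ measurableSet_Ioi fun y hy => ?_
    rw [abs_of_nonneg hx, abs_of_nonneg (hx.trans (le_of_lt hy))]
    exact le_of_lt hy

theorem exists_norm_primitive_source_le {w h : Lp ℂ 2 (volume : Measure ℝ)} {α s : ℝ}
    (hα : 0 ≤ α) (hs : 0 ≤ s) (hw : MemLp (fun x => (weight α x : ℂ) * w x) 2 volume)
    (hh : MemLp (fun x => (weight s x : ℂ) * h x) 2 volume)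
    (h0 : ∫ x, source w h x = 0) :
    ∃ C, ∀ x, ‖primitive (source w h) x‖ * weight (α + s) x ≤ C := by
  refine ⟨_, norm_primitive_mul_weight_le (integrable_source w h) h0 (add_nonneg hα hs) ?_⟩
  have := (MemLp.integrable_mul (p := 2) (q := 2) hw hh).norm
  refine this.congr (Eventually.of_forall fun x => ?_)
  simp only [Pi.mul_apply]
  rw [norm_source, weight_add]
  simp only [norm_mul, Complex.norm_real, Real.norm_of_nonneg (weight_pos _ x).le]
  ring

/-- One step of the decay bootstrap. -/
theorem memLp_weight_step {w p : Lp ℂ 2 (volume : Measure ℝ)} {α s σ : ℝ}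
    (hα : 0 ≤ α) (hs : 0 ≤ s) (hσ : 0 ≤ σ) (hσ1 : σ < 1 / 2)
    (hw : MemLp (fun x => (weight α x : ℂ) * w x) 2 volume)
    (hp : p =ᵐ[volume] fun x => w x * primitive (source w (szego p)) x)
    (h0 : ∫ x, source w (szego p) x = 0)
    (hh : MemLp (fun x => (weight s x : ℂ) * szego p x) 2 volume) (hle : σ ≤ s + 2 * α) :
    MemLp (fun x => (weight σ x : ℂ) * szego p x) 2 volume := by
  obtain ⟨C, hC⟩ := exists_norm_primitive_source_le hα hs hw hh h0
  refine memLp_weight_szego hσ hσ1 p (memLp_weight_of_le hle (Lp.aestronglyMeasurable p) ?_)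
  have hc := continuous_primitive (integrable_source w (szego p))
  -- The gain is `2α`: one `α` from `w̄` inside the primitive, one from the factor `w` in front.
  have h1 : MemLp (fun x => ((weight (α + s) x : ℂ) * primitive (source w (szego p)) x) *
      ((weight α x : ℂ) * w x)) 2 volume := by
    refine memLp_bounded_mul hw ((Complex.continuous_ofReal.comp
      (continuous_weight _)).mul hc).aestronglyMeasurable (C := C) fun x => ?_
    rw [norm_mul, Complex.norm_real, Real.norm_of_nonneg (weight_pos _ x).le, mul_comm]
    exact hC x
  refine (memLp_congr_ae ?_).1 h1
  filter_upwards [hp] with x hx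
  rw [hx, show s + 2 * α = (α + s) + α by ring, weight_add (α + s) α]
  push_cast; ring

/-- Iterate `memLp_weight_step` from weight `0`, gaining `2α` each time and capping at `σ`; finitely
many steps suffice since `α > 0`. -/
theorem memLp_weight_szego_of_lt_half {w p : Lp ℂ 2 (volume : Measure ℝ)} {α σ : ℝ}
    (hα : 0 < α) (hσ : 0 ≤ σ) (hσ1 : σ < 1 / 2)
    (hw : MemLp (fun x => (weight α x : ℂ) * w x) 2 volume)
    (hp : p =ᵐ[volume] fun x => w x * primitive (source w (szego p)) x)
    (h0 : ∫ x, source w (szego p) x = 0) :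
    MemLp (fun x => (weight σ x : ℂ) * szego p x) 2 volume := by
  have h : ∀ n : ℕ, MemLp (fun x => (weight (min σ (n * (2 * α))) x : ℂ) * szego p x) 2 volume := by
    intro n
    induction n with
    | zero =>
      have : min σ (((0 : ℕ) : ℝ) * (2 * α)) = 0 := by simp [hσ]
      rw [this]
      simpa [weight_zero] using Lp.memLp (szego p)
    | succ n ih =>
      have hn : 0 ≤ min σ ((n : ℝ) * (2 * α)) := le_min hσ (by positivity)
      refine memLp_weight_step hα.le hn (le_min hσ (by positivity))
        ((min_le_left _ _).trans_lt hσ1) hw hp h0 ih ?_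
      rcases le_total σ ((n : ℝ) * (2 * α)) with h | h
      · rw [min_eq_left h]
        exact (min_le_left _ _).trans (by linarith)
      · rw [min_eq_right h]
        exact (min_le_right _ _).trans (by push_cast; linarith)
  obtain ⟨n, hn⟩ := exists_nat_ge (σ / (2 * α))
  have := h n
  rwa [min_eq_left ((div_le_iff₀ (by positivity)).1 hn)] at this

/-- There is no nonzero bounded solution that vanishes at `-∞`. -/
theorem eq_zero_of_vanishing {w p : Lp ℂ 2 (volume : Measure ℝ)} {α : ℝ} (hα : 0 < α)
    (hw : MemLp (fun x => (weight α x : ℂ) * w x) 2 volume)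
    (hp : p =ᵐ[volume] fun x => w x * primitive (source w (szego p)) x) : p = 0 := by
  have hp' : p =ᵐ[volume] fun x => w x * (0 + primitive (source w (szego p)) x) := by
    simpa only [zero_add] using hp
  have h0 : ∫ x, source w (szego p) x = 0 := by
    have := norm_add_integral_source hp'
    simpa using this
  set n := source w (szego p) with hn_def
  have hn : Integrable n := integrable_source w (szego p)
  -- Chosen so that `0 ≤ σ < 1/2`, where `Π` is bounded, while `α + σ > 1/2`, so that decay like
  -- `⟨x⟩^{-(α+σ)}` is square integrable.
  set σ := max 0 (1 / 2 - α / 2)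
  have hσ : 0 ≤ σ := le_max_left _ _
  have hσ1 : σ < 1 / 2 := max_lt (by norm_num) (by linarith)
  have hσ2 : 1 / 2 < α + σ := by
    rcases le_total 0 (1 / 2 - α / 2) with h | h
    · have : 1 / 2 - α / 2 ≤ σ := le_max_right _ _
      linarith
    · linarith
  obtain ⟨C, hC⟩ := exists_norm_primitive_source_le hα.le hσ hw
    (memLp_weight_szego_of_lt_half hα hσ hσ1 hw hp h0) h0
  have hc := continuous_primitive hn
  have hN2 : Integrable (fun x => ‖primitive n x‖ ^ 2) := by
    have hi : Integrable (fun x : ℝ => C ^ 2 * ((1 : ℝ) + ‖x‖ ^ 2) ^ (-(2 * (α + σ)) / 2)) :=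
      (integrable_rpow_neg_one_add_norm_sq (by
        rw [Module.finrank_self]; push_cast; linarith)).const_mul _
    refine hi.mono' (hc.norm.pow 2).aestronglyMeasurable (Eventually.of_forall fun x => ?_)
    have hW := weight_pos (α + σ) x
    have h1 : ((1 : ℝ) + ‖x‖ ^ 2) ^ (-(2 * (α + σ)) / 2) = (weight (α + σ) x ^ 2)⁻¹ := by
      rw [weight, Real.norm_eq_abs, sq_abs, ← Real.rpow_natCast (_ ^ ((α + σ) / 2)) 2, ← Real.rpow_mul (by positivity),
        ← Real.rpow_neg (by positivity)]
      congr 1; push_cast; ring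
    rw [h1, ← div_eq_mul_inv, le_div_iff₀ (by positivity), Real.norm_of_nonneg (by positivity),
      ← mul_pow]
    exact pow_le_pow_left₀ (by positivity) (hC x) 2
  have hNm : MemLp (primitive n) 2 volume :=
    (memLp_two_iff_integrable_sq_norm hc.aestronglyMeasurable).2 hN2
  have hpi : Integrable p := by
    refine Integrable.congr ?_ hp.symm
    exact MemLp.integrable_mul (p := 2) (q := 2) (Lp.memLp w) hNm
  set j : ℝ → ℂ := fun x => (starRingEnd ℂ) (0 + primitive n x) * n x with hj_def
  have hj : Integrable j := by
    have := integrable_mul_primitive hn (integrable_conj hn)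
    refine this.congr (Eventually.of_forall fun x => ?_)
    simp only [hj_def, primitive_conj, zero_add, mul_comm]
  -- `J = 2 Re (f̄ f')` is the derivative of `|f|²`, for `f = primitive n`.
  set J : ℝ → ℂ := fun x => j x + (starRingEnd ℂ) (j x) with hJ_def
  have hJ : Integrable J := hj.add (integrable_conj hj)
  have hJprim : ∀ X, primitive J X = ((‖primitive n X‖ ^ 2 : ℝ) : ℂ) := by
    intro X
    have h1 : primitive J X = primitive j X + (starRingEnd ℂ) (primitive j X) := by
      rw [← primitive_conj]
      exact integral_add hj.integrableOn (integrable_conj hj).integrableOn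
    have h2 := normSq_add_primitive hn 0 X
    simp only [zero_add, norm_zero, ne_eq, OfNat.ofNat_ne_zero, not_false_eq_true, zero_pow] at h2
    rw [h1, Complex.add_conj, h2]
    simp only [hj_def, zero_add]
  have hJfun : primitive J = fun x => ((‖primitive n x‖ ^ 2 : ℝ) : ℂ) := funext hJprim
  have hJ0 : ∫ x, J x = 0 := by
    refine tendsto_nhds_unique (tendsto_primitive_atTop hJ) ?_
    rw [hJfun]
    have := tendsto_primitive_atTop hn
    rw [h0] at this
    have h2 := (Complex.continuous_ofReal.tendsto _).comp (this.norm.pow 2)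
    simpa [Function.comp_def] using h2
  have hJp : J =ᵐ[volume] fun x => -Complex.I * ((starRingEnd ℂ) (p x) * szego p x -
      p x * (starRingEnd ℂ) (szego p x)) := by
    filter_upwards [integral_conj_mul_source hp'] with x hx
    simp only [hJ_def, hj_def]
    rw [hx]
    simp only [map_mul, map_neg, Complex.conj_I, Complex.conj_conj]; ring
  have hF : Integrable (primitive J) := by
    rw [hJfun]; exact hN2.ofReal
  have key := integral_primitive_eq p hpi hJ hJp hJ0 hF
  have hint : ∫ x, primitive J x = ((∫ x, ‖primitive n x‖ ^ 2 : ℝ) : ℂ) := by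
    rw [hJfun]; exact integral_ofReal
  rw [hint] at key
  -- The left side is nonnegative and the right side nonpositive, so both vanish.
  have key' : 2 * Real.pi * ∫ x, ‖primitive n x‖ ^ 2 = -(‖∫ x, p x‖ ^ 2) := by
    exact_mod_cast key
  have hnn : 0 ≤ ∫ x, ‖primitive n x‖ ^ 2 := integral_nonneg fun x => by positivity
  have hzero : ∫ x, ‖primitive n x‖ ^ 2 = 0 := by
    refine le_antisymm ?_ hnn
    have := Real.pi_pos
    by_contra hcon
    push Not at hcon
    have h1 : 0 < 2 * Real.pi * ∫ x, ‖primitive n x‖ ^ 2 := by positivity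
    rw [key'] at h1
    linarith [sq_nonneg ‖∫ x, p x‖]
  have hae := (integral_eq_zero_iff_of_nonneg (fun x => by positivity) hN2).1 hzero
  rw [Lp.eq_zero_iff_ae_eq_zero]
  filter_upwards [hp, hae] with x hx hx2
  have : primitive n x = 0 := by simpa using hx2
  rw [hx, this, mul_zero, Pi.zero_apply]

/-! ### Compactness of the Volterra operator and existence -/

theorem norm_sq_eq_integral (f : Lp ℂ 2 (volume : Measure ℝ)) : ‖f‖ ^ 2 = ∫ x, ‖f x‖ ^ 2 := by
  have h := inner_eq_integral f f
  rw [inner_self_eq_norm_sq_to_K] at h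
  have h2 : ∫ x, (starRingEnd ℂ) (f x) * f x = ((∫ x, ‖f x‖ ^ 2 : ℝ) : ℂ) := by
    refine Eq.trans ?_ (integral_ofReal (𝕜 := ℂ))
    congr 1; funext x
    rw [← Complex.normSq_eq_conj_mul_self, Complex.normSq_eq_norm_sq]
    rfl
  rw [h2] at h
  rw [← Complex.ofReal_inj, Complex.ofReal_pow]
  exact h

/-- The restriction of `w` to the set `S`. -/
def cutoff (w : Lp ℂ 2 (volume : Measure ℝ)) {S : Set ℝ} (hS : MeasurableSet S) :
    Lp ℂ 2 (volume : Measure ℝ) := ((Lp.memLp w).indicator hS).toLp _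

theorem coeFn_cutoff (w : Lp ℂ 2 (volume : Measure ℝ)) {S : Set ℝ} (hS : MeasurableSet S) :
    cutoff w hS =ᵐ[volume] S.indicator w := ((Lp.memLp w).indicator hS).coeFn_toLp

theorem norm_cutoff_sq (w : Lp ℂ 2 (volume : Measure ℝ)) {S : Set ℝ} (hS : MeasurableSet S) :
    ‖cutoff w hS‖ ^ 2 = ∫ x in S, ‖w x‖ ^ 2 := by
  rw [norm_sq_eq_integral, ← integral_indicator hS]
  refine integral_congr_ae ?_
  filter_upwards [coeFn_cutoff w hS] with x hx
  rw [hx]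
  by_cases h : x ∈ S <;> simp [h]

theorem setIntegral_source (w h : Lp ℂ 2 (volume : Measure ℝ)) {S : Set ℝ}
    (hS : MeasurableSet S) :
    ∫ x in S, source w h x = -Complex.I * inner ℂ (cutoff w hS) h := by
  rw [inner_eq_integral, ← integral_const_mul, ← integral_indicator hS]
  refine integral_congr_ae ?_
  filter_upwards [coeFn_cutoff w hS] with x hx
  rw [hx]
  by_cases h : x ∈ S <;> simp [h, source]

theorem primitive_source_eq (w h : Lp ℂ 2 (volume : Measure ℝ)) (x : ℝ) :
    primitive (source w h) x = -Complex.I * inner ℂ (cutoff w (measurableSet_Iic (a := x))) h :=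
  setIntegral_source w h measurableSet_Iic

theorem norm_cutoff_le (w : Lp ℂ 2 (volume : Measure ℝ)) {S : Set ℝ} (hS : MeasurableSet S) :
    ‖cutoff w hS‖ ≤ ‖w‖ := by
  refine Lp.norm_le_norm_of_ae_le ?_
  filter_upwards [coeFn_cutoff w hS] with x hx
  rw [hx]
  exact norm_indicator_le_norm_self _ _

theorem norm_primitive_source_le (w h : Lp ℂ 2 (volume : Measure ℝ)) (x : ℝ) :
    ‖primitive (source w h) x‖ ≤ ‖w‖ * ‖h‖ := by
  rw [primitive_source_eq, norm_mul, norm_neg, Complex.norm_I, one_mul]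
  exact (norm_inner_le_norm _ _).trans (by gcongr; exact norm_cutoff_le w _)

/-- The functional `h ↦ -i ∫_{-∞}^a w̄ h`. -/
def primitiveSourceCLM (w : Lp ℂ 2 (volume : Measure ℝ)) (a : ℝ) :
    Lp ℂ 2 (volume : Measure ℝ) →L[ℂ] ℂ :=
  (-Complex.I) • innerSL ℂ (cutoff w (measurableSet_Iic (a := a)))

theorem primitiveSourceCLM_apply (w h : Lp ℂ 2 (volume : Measure ℝ)) (a : ℝ) :
    primitiveSourceCLM w a h = primitive (source w h) a := by
  rw [primitive_source_eq]; rfl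

theorem memLp_volterra (w h : Lp ℂ 2 (volume : Measure ℝ)) :
    MemLp (fun x => primitive (source w h) x * w x) 2 volume :=
  memLp_bounded_mul (Lp.memLp w)
    (continuous_primitive (integrable_source w h)).aestronglyMeasurable
    (norm_primitive_source_le w h)

/-- The Volterra operator `h ↦ -i w ∫_{-∞}^x w̄ h` on `L²(ℝ)`. -/
def volterra (w : Lp ℂ 2 (volume : Measure ℝ)) :
    Lp ℂ 2 (volume : Measure ℝ) →L[ℂ] Lp ℂ 2 (volume : Measure ℝ) :=
  LinearMap.mkContinuous
    { toFun := fun h => (memLp_volterra w h).toLp _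
      map_add' := fun h h' => by
        rw [← MemLp.toLp_add]
        refine MemLp.toLp_congr _ _ (Eventually.of_forall fun x => ?_)
        simp only [Pi.add_apply, ← primitiveSourceCLM_apply, map_add, add_mul]
      map_smul' := fun c h => by
        rw [← MemLp.toLp_const_smul]
        refine MemLp.toLp_congr _ _ (Eventually.of_forall fun x => ?_)
        simp only [Pi.smul_apply, ← primitiveSourceCLM_apply, map_smul, smul_eq_mul,
          RingHom.id_apply, mul_assoc] }
    (‖w‖ * ‖w‖) fun h => by
      rw [mul_right_comm]
      refine Lp.norm_le_mul_norm_of_ae_le_mul ?_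
      filter_upwards [(memLp_volterra w h).coeFn_toLp] with x hx
      simp only [LinearMap.coe_mk, AddHom.coe_mk]
      rw [hx, norm_mul]
      gcongr
      exact norm_primitive_source_le w h x

theorem coeFn_volterra (w h : Lp ℂ 2 (volume : Measure ℝ)) :
    volterra w h =ᵐ[volume] fun x => primitive (source w h) x * w x :=
  (memLp_volterra w h).coeFn_toLp

/-- The mass of `|w|²` to the left of `x`. -/
def mass (w : Lp ℂ 2 (volume : Measure ℝ)) (x : ℝ) : ℝ := ∫ y in Iic x, ‖w y‖ ^ 2

theorem integrable_norm_sq (w : Lp ℂ 2 (volume : Measure ℝ)) : Integrable (fun x => ‖w x‖ ^ 2) :=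
  (memLp_two_iff_integrable_sq_norm (Lp.aestronglyMeasurable w)).1 (Lp.memLp w)

theorem mass_nonneg (w : Lp ℂ 2 (volume : Measure ℝ)) (x : ℝ) : 0 ≤ mass w x :=
  integral_nonneg fun y => by positivity

theorem mass_le (w : Lp ℂ 2 (volume : Measure ℝ)) (x : ℝ) : mass w x ≤ ‖w‖ ^ 2 := by
  rw [norm_sq_eq_integral]
  exact setIntegral_le_integral (integrable_norm_sq w) (Eventually.of_forall fun y => by positivity)

theorem monotone_mass (w : Lp ℂ 2 (volume : Measure ℝ)) : Monotone (mass w) := fun x y hxy =>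
  setIntegral_mono_set (integrable_norm_sq w).integrableOn
    (Eventually.of_forall fun y => by positivity) (Iic_subset_Iic.2 hxy).eventuallyLE

/-- Cauchy–Schwarz on `(x, y]`. The primitives for `‖h‖ ≤ 1` are thus equicontinuous in the variable
`mass w`, which ranges in a bounded interval; compactness rests on this. -/
theorem norm_primitive_source_sub_sq_le (w h : Lp ℂ 2 (volume : Measure ℝ)) (x y : ℝ) :
    ‖primitive (source w h) y - primitive (source w h) x‖ ^ 2 ≤
      |mass w y - mass w x| * ‖h‖ ^ 2 := by
  wlog hxy : x ≤ y generalizing x y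
  · rw [norm_sub_rev, abs_sub_comm]
    exact this y x (le_of_not_ge hxy)
  have hi := integrable_norm_sq w
  rw [primitive_sub (integrable_source w h), intervalIntegral.integral_of_le hxy,
    setIntegral_source w h measurableSet_Ioc, norm_mul, norm_neg, Complex.norm_I, one_mul, mass,
    mass, intervalIntegral.integral_Iic_sub_Iic hi.integrableOn hi.integrableOn,
    intervalIntegral.integral_of_le hxy, ← norm_cutoff_sq w measurableSet_Ioc,
    abs_of_nonneg (by positivity), ← mul_pow]
  gcongr
  exact norm_inner_le_norm _ _

theorem isCompactOperator_smulRight {E F : Type*} [NormedAddCommGroup E] [NormedSpace ℂ E]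
    [NormedAddCommGroup F] [NormedSpace ℂ F] (l : E →L[ℂ] ℂ) (g : F) :
    IsCompactOperator (l.smulRight g) :=
  (isCompactOperator_of_locallyCompactSpace_rng
    (ContinuousLinearMap.toSpanSingleton ℂ g)).comp_clm l

theorem isCompactOperator_sum {E F ι : Type*} [NormedAddCommGroup E] [NormedSpace ℂ E]
    [NormedAddCommGroup F] [NormedSpace ℂ F] (s : Finset ι) (T : ι → E →L[ℂ] F)
    (h : ∀ i, IsCompactOperator (T i)) : IsCompactOperator (∑ i ∈ s, T i : E →L[ℂ] F) := by
  classical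
  induction s using Finset.induction_on with
  | empty =>
    rw [Finset.sum_empty]
    exact isCompactOperator_zero
  | insert i s hi ih =>
    rw [Finset.sum_insert hi]
    exact (h i).add ih

/-- `volterra w` is approximated in norm by operators of finite rank. -/
theorem exists_compact_near_volterra (w : Lp ℂ 2 (volume : Measure ℝ)) (n : ℕ) :
    ∃ T : Lp ℂ 2 (volume : Measure ℝ) →L[ℂ] Lp ℂ 2 (volume : Measure ℝ),
      IsCompactOperator T ∧ ‖T - volterra w‖ ≤ √(1 / ((n : ℝ) + 1)) * ‖w‖ := by
  -- The line is split into level sets of `k`, on which the mass varies by at most `1/(n+1)`; the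
  -- bound `mass w ≤ ‖w‖²` leaves finitely many of them.
  set k : ℝ → ℕ := fun x => ⌊mass w x * ((n : ℝ) + 1)⌋₊ with hk_def
  have hk : Measurable k :=
    Nat.measurable_floor.comp ((monotone_mass w).measurable.mul_const _)
  have hkS : ∀ i, MeasurableSet (k ⁻¹' {i}) := fun i => hk (measurableSet_singleton i)
  -- A sample point for each level, at which the primitive is frozen. For a level not attained the
  -- choice is irrelevant, as its level set is empty.
  obtain ⟨a, ha⟩ : ∃ a : ℕ → ℝ, ∀ x, k (a (k x)) = k x := by
    refine ⟨Function.invFun k, fun x => Function.invFun_eq ⟨x, rfl⟩⟩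
  have hkK : ∀ x, k x ∈ Finset.range (⌊‖w‖ ^ 2 * ((n : ℝ) + 1)⌋₊ + 1) := fun x => by
    rw [Finset.mem_range, Nat.lt_succ_iff]
    refine Nat.floor_le_floor ?_
    have := mass_le w x
    gcongr
  set s := Finset.range (⌊‖w‖ ^ 2 * ((n : ℝ) + 1)⌋₊ + 1)
  have hclose : ∀ x, |mass w x - mass w (a (k x))| ≤ 1 / ((n : ℝ) + 1) := fun x => by
    have hn : (0 : ℝ) < (n : ℝ) + 1 := by positivity
    have h1 := ha x
    have m1 := mul_nonneg (mass_nonneg w x) hn.le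
    have m2 := mul_nonneg (mass_nonneg w (a (k x))) hn.le
    have f1 := Nat.floor_le m1
    have f2 := Nat.floor_le m2
    have g1 := Nat.lt_floor_add_one (mass w x * ((n : ℝ) + 1))
    have g2 := Nat.lt_floor_add_one (mass w (a (k x)) * ((n : ℝ) + 1))
    have e : ((⌊mass w (a (k x)) * ((n : ℝ) + 1)⌋₊ : ℕ) : ℝ) = ⌊mass w x * ((n : ℝ) + 1)⌋₊ :=
      congrArg Nat.cast h1
    rw [e] at f2 g2
    rw [le_div_iff₀ hn]
    nth_rewrite 1 [← abs_of_pos hn]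
    rw [← abs_mul, sub_mul, abs_le]
    constructor <;> linarith
  refine ⟨∑ i ∈ s, (primitiveSourceCLM w (a i)).smulRight (cutoff w (hkS i)),
    isCompactOperator_sum _ _ fun i => isCompactOperator_smulRight _ _, ?_⟩
  refine ContinuousLinearMap.opNorm_le_bound _ (by positivity) fun h => ?_
  rw [mul_right_comm]
  refine Lp.norm_le_mul_norm_of_ae_le_mul ?_
  have hsum : ((∑ i ∈ s, (primitiveSourceCLM w (a i)).smulRight (cutoff w (hkS i)) :
      Lp ℂ 2 (volume : Measure ℝ) →L[ℂ] Lp ℂ 2 (volume : Measure ℝ)) h : ℝ → ℂ) =ᵐ[volume]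
      fun x => primitive (source w h) (a (k x)) * w x := by
    rw [_root_.sum_apply]
    refine (Lp.coeFn_finsetSum _ _).trans ?_
    have hall : ∀ᵐ x : ℝ, ∀ i : ℕ,
        (((primitiveSourceCLM w (a i)).smulRight (cutoff w (hkS i)) h :
          Lp ℂ 2 (volume : Measure ℝ)) x = primitive (source w h) (a i) *
          (k ⁻¹' {i}).indicator w x) := by
      rw [ae_all_iff]
      intro i
      rw [ContinuousLinearMap.smulRight_apply]
      filter_upwards [Lp.coeFn_smul (primitiveSourceCLM w (a i) h) (cutoff w (hkS i)),
        coeFn_cutoff w (hkS i)] with x h1 h2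
      rw [h1, Pi.smul_apply, h2, smul_eq_mul, primitiveSourceCLM_apply]
    filter_upwards [hall] with x hx
    rw [Finset.sum_apply]
    simp_rw [hx]
    rw [Finset.sum_eq_single_of_mem (k x) (hkK x)]
    · rw [indicator_of_mem (by simp)]
    · intro i _ hi
      rw [indicator_of_notMem (by simpa using hi.symm), mul_zero]
  rw [_root_.sub_apply]
  filter_upwards [hsum, coeFn_volterra w h, Lp.coeFn_sub
    ((∑ i ∈ s, (primitiveSourceCLM w (a i)).smulRight (cutoff w (hkS i)) :
      Lp ℂ 2 (volume : Measure ℝ) →L[ℂ] Lp ℂ 2 (volume : Measure ℝ)) h) (volterra w h)]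
    with x h1 h2 h3
  rw [h3, Pi.sub_apply, h1, h2, ← sub_mul, norm_mul]
  gcongr
  refine abs_le_of_sq_le_sq' ?_ (by positivity) |>.2
  rw [mul_pow, Real.sq_sqrt (by positivity), norm_sub_rev]
  refine (norm_primitive_source_sub_sq_le w h _ _).trans ?_
  gcongr
  exact hclose x

theorem isCompactOperator_volterra (w : Lp ℂ 2 (volume : Measure ℝ)) :
    IsCompactOperator (volterra w) := by
  choose T hT hT' using exists_compact_near_volterra w
  refine isCompactOperator_of_tendsto (F := T) (l := atTop) ?_ (Eventually.of_forall hT)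
  rw [tendsto_iff_norm_sub_tendsto_zero]
  refine squeeze_zero (fun n => norm_nonneg _) hT' ?_
  have h := (tendsto_one_div_add_atTop_nhds_zero_nat (𝕜 := ℝ)).sqrt.mul_const ‖w‖
  simpa using h

/-- Existence: for every `c` there is `p = w (c + ∫_{-∞}^x (-i) w̄ Πp)`. -/
theorem exists_solution {w : Lp ℂ 2 (volume : Measure ℝ)} {α : ℝ} (hα : 0 < α)
    (hw : MemLp (fun x => (weight α x : ℂ) * w x) 2 volume) (c : ℂ) :
    ∃ p : Lp ℂ 2 (volume : Measure ℝ),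
      p =ᵐ[volume] fun x => w x * (c + primitive (source w (szego p)) x) := by
  set T := szego ∘L volterra w with hT_def
  have hT : IsCompactOperator T := (isCompactOperator_volterra w).clm_comp szego
  have hres : (1 : ℂ) ∈ resolventSet ℂ T := by
    refine (hT.hasEigenvalue_or_mem_resolventSet one_ne_zero).resolve_left fun hev => ?_
    obtain ⟨h, hh⟩ := hev.exists_hasEigenvector
    have h1 : szego (volterra w h) = h := by
      have := hh.apply_eq_smul
      rwa [one_smul] at this
    -- For an eigenvector `h = ΠVh`, the function `Vh` solves the problem with `c = 0`; it vanishes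
    -- by uniqueness, and so does `h`.
    refine hh.2 ?_
    have h2 : volterra w h = 0 := by
      refine eq_zero_of_vanishing hα hw ?_
      rw [h1]
      filter_upwards [coeFn_volterra w h] with x hx
      rw [hx, mul_comm]
    rw [← h1, h2, map_zero]
  obtain ⟨h, hh⟩ : ∃ h, h - T h = szego (c • w) := by
    generalize szego (c • w) = y
    obtain ⟨S, hS⟩ := (spectrum.mem_resolventSet_iff.1 hres)
    refine ⟨(↑S⁻¹ : Lp ℂ 2 (volume : Measure ℝ) →L[ℂ] Lp ℂ 2 (volume : Measure ℝ)) y, ?_⟩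
    have h1 := congrArg (fun A : Lp ℂ 2 (volume : Measure ℝ) →L[ℂ] Lp ℂ 2 (volume : Measure ℝ) =>
      A y) S.mul_inv
    rw [hS] at h1
    simpa using h1
  -- The equation for `h` says exactly that `Π` of this function is `h`.
  refine ⟨c • w + volterra w h, ?_⟩
  have h1 : szego (c • w + volterra w h) = h := by
    rw [map_add, ← hh]
    exact sub_add_cancel _ _
  rw [h1]
  filter_upwards [coeFn_volterra w h, Lp.coeFn_add (c • w) (volterra w h), Lp.coeFn_smul c w]
    with x e1 e2 e3
  rw [e2, Pi.add_apply, e1, e3, Pi.smul_apply, smul_eq_mul]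
  ring

/-! ### The equation in integral form -/

/-- The plane wave `e^{iλx}`. -/
def wave (lam x : ℝ) : ℂ := Complex.exp (Complex.I * lam * x)

theorem continuous_wave (lam : ℝ) : Continuous (wave lam) := by
  unfold wave; fun_prop

theorem norm_wave (lam x : ℝ) : ‖wave lam x‖ = 1 := by
  rw [wave, show Complex.I * lam * x = ((lam * x : ℝ) : ℂ) * Complex.I by push_cast; ring]
  exact norm_exp_ofReal_mul_I' _

theorem conj_wave (lam x : ℝ) :
    (starRingEnd ℂ) (wave lam x) = Complex.exp (-(Complex.I * lam * x)) := by
  rw [wave, ← Complex.exp_conj]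
  simp

theorem exp_mul_wave (lam x : ℝ) : Complex.exp (-(Complex.I * lam * x)) * wave lam x = 1 := by
  rw [wave, ← Complex.exp_add]; simp

theorem memLp_twist (u : Lp ℂ 2 (volume : Measure ℝ)) (lam : ℝ) :
    MemLp (fun x => wave lam x * (starRingEnd ℂ) (u x)) 2 volume :=
  memLp_bounded_mul (Lp.memLp u).star (continuous_wave lam).aestronglyMeasurable
    fun x => (norm_wave lam x).le

/-- The function `w = ū e^{iλx}`. -/
def twist (u : Lp ℂ 2 (volume : Measure ℝ)) (lam : ℝ) : Lp ℂ 2 (volume : Measure ℝ) :=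
  (memLp_twist u lam).toLp _

theorem coeFn_twist (u : Lp ℂ 2 (volume : Measure ℝ)) (lam : ℝ) :
    twist u lam =ᵐ[volume] fun x => wave lam x * (starRingEnd ℂ) (u x) :=
  (memLp_twist u lam).coeFn_toLp

theorem weight_le_of_nonneg {α : ℝ} (hα : 0 ≤ α) (x : ℝ) :
    weight α x ≤ 2 ^ (α / 2) * (1 + |x| ^ α) := by
  have h2 : (0 : ℝ) ≤ 2 ^ (α / 2) := by positivity
  have hx : 0 ≤ |x| ^ α := by positivity
  rcases le_total |x| 1 with h | h
  · calc weight α x ≤ 2 ^ (α / 2) := by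
          refine Real.rpow_le_rpow (by positivity) ?_ (by positivity)
          nlinarith [sq_abs x, abs_nonneg x]
      _ ≤ _ := by nlinarith
  · calc weight α x ≤ (2 * x ^ 2) ^ (α / 2) := by
          refine Real.rpow_le_rpow (by positivity) ?_ (by positivity)
          nlinarith [sq_abs x, abs_nonneg x]
      _ = 2 ^ (α / 2) * |x| ^ α := by
          rw [Real.mul_rpow (by positivity) (by positivity), ← sq_abs, ← Real.rpow_natCast |x| 2,
            ← Real.rpow_mul (abs_nonneg x)]
          congr 2; push_cast; ring
      _ ≤ _ := by nlinarith

theorem memLp_weight_twist {α : ℝ} (hα : 0 ≤ α) {u : Lp ℂ 2 (volume : Measure ℝ)}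
    (hu : u ∈ weightedHardy α) (lam : ℝ) :
    MemLp (fun x => (weight α x : ℂ) * twist u lam x) 2 volume := by
  have h1 := ((Lp.memLp u).norm.add hu.2.norm).const_mul (2 ^ (α / 2))
  refine h1.of_le ((Complex.continuous_ofReal.comp
    (continuous_weight α)).aestronglyMeasurable.mul (Lp.aestronglyMeasurable _)) ?_
  filter_upwards [coeFn_twist u lam] with x hx
  rw [hx]
  simp only [norm_mul, Complex.norm_real, norm_wave, RCLike.norm_conj, one_mul, Pi.add_apply]
  rw [Real.norm_of_nonneg (weight_pos _ _).le, Real.norm_of_nonneg (by positivity : 0 ≤ |x| ^ α),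
    Real.norm_of_nonneg (by positivity : (0:ℝ) ≤ 2 ^ (α / 2)),
    Real.norm_of_nonneg (by positivity : 0 ≤ ‖u x‖ + |x| ^ α * ‖u x‖)]
  calc _ ≤ 2 ^ (α / 2) * (1 + |x| ^ α) * ‖u x‖ := by
        gcongr; exact weight_le_of_nonneg hα x
    _ = _ := by ring

/-- The du Bois-Reymond lemma. -/
theorem exists_ae_eq_const {g : ℝ → ℂ} (hg : LocallyIntegrable g)
    (h : ∀ ψ : 𝓢(ℝ, ℂ), ∫ x, deriv ψ x * g x = 0) : ∃ c : ℂ, ∀ᵐ x, g x = c := by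
  let b : ContDiffBump (0 : ℝ) := default
  set ρ : ℝ → ℝ := b.normed volume with hρ_def
  have hρ : ContDiff ℝ ((⊤ : ℕ∞) : WithTop ℕ∞) ρ := b.contDiff_normed
  have hρc : HasCompactSupport ρ := b.hasCompactSupport_normed
  have hρ1 : ∫ x, ρ x = 1 := b.integral_normed
  refine ⟨∫ x, ρ x • g x, ?_⟩
  refine ae_eq_of_integral_contDiff_smul_eq hg continuous_const.locallyIntegrable
    fun φ hφ hφc => ?_
  -- Subtracting the multiple of `ρ` with the same integral makes the mean zero, so the primitive
  -- `Θ` has compact support and is an admissible test function.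
  set θ : ℝ → ℝ := fun x => φ x - (∫ y, φ y) * ρ x with hθ_def
  have hθ : ContDiff ℝ ((⊤ : ℕ∞) : WithTop ℕ∞) θ := hφ.sub (contDiff_const.mul hρ)
  have hθc : HasCompactSupport θ := hφc.sub (hρc.mul_left)
  have iφ : Integrable φ := hφ.continuous.integrable_of_hasCompactSupport hφc
  have iρ : Integrable ρ := hρ.continuous.integrable_of_hasCompactSupport hρc
  have iθ : Integrable θ := hθ.continuous.integrable_of_hasCompactSupport hθc
  have hθ0 : ∫ x, θ x = 0 := by
    rw [hθ_def, integral_sub iφ (iρ.const_mul _), integral_const_mul, hρ1]; ring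
  set Θ : ℝ → ℝ := fun x => ∫ y in Iic x, θ y with hΘ_def
  have hΘd : ∀ x, HasDerivAt Θ (θ x) x := fun x => by
    have h1 : Θ = fun x => Θ 0 + ∫ t in (0 : ℝ)..x, θ t := by
      funext y
      rw [← intervalIntegral.integral_Iic_sub_Iic iθ.integrableOn iθ.integrableOn]
      simp only [hΘ_def]; ring
    rw [h1]
    exact (hθ.continuous.integral_hasStrictDerivAt 0 x).hasDerivAt.const_add _
  have hΘ : ContDiff ℝ ((⊤ : ℕ∞) : WithTop ℕ∞) Θ := by
    rw [contDiff_infty_iff_deriv]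
    refine ⟨fun x => (hΘd x).differentiableAt, ?_⟩
    rwa [funext fun x => (hΘd x).deriv]
  have hΘc : HasCompactSupport Θ := by
    obtain ⟨R, hR⟩ := hθc.isCompact.isBounded.subset_closedBall 0
    have hout : ∀ y, R < |y| → θ y = 0 := fun y hy => by
      refine image_eq_zero_of_notMem_tsupport fun h' => ?_
      have := hR h'
      rw [mem_closedBall_zero_iff, Real.norm_eq_abs] at this
      linarith
    refine HasCompactSupport.of_support_subset_isCompact (isCompact_Icc (a := -R) (b := R))
      fun x hx => ?_
    by_contra hxR
    apply hx
    rw [mem_Icc, not_and_or, not_le, not_le] at hxR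
    rcases hxR with h1 | h1
    · refine setIntegral_eq_zero_of_forall_eq_zero fun y hy => hout y ?_
      rw [mem_Iic] at hy
      exact lt_of_lt_of_le (by linarith) (neg_le_abs y)
    · have h2 : Θ x + ∫ y in Ioi x, θ y = 0 := by
        rw [← hθ0]
        exact intervalIntegral.integral_Iic_add_Ioi iθ.integrableOn iθ.integrableOn
      rw [setIntegral_eq_zero_of_forall_eq_zero (t := Ioi x) fun y hy => hout y ?_, add_zero] at h2
      · exact h2
      · rw [mem_Ioi] at hy
        exact lt_of_lt_of_le (by linarith) (le_abs_self y)
  have h₁ : HasCompactSupport (Complex.ofRealCLM ∘ Θ) := hΘc.comp_left rfl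
  have h₂ : ContDiff ℝ ((⊤ : ℕ∞) : WithTop ℕ∞) (Complex.ofRealCLM ∘ Θ) := by fun_prop
  have h3 := h (h₁.toSchwartzMap h₂)
  have h4 : ∀ x, deriv (h₁.toSchwartzMap h₂) x = (θ x : ℂ) := fun x =>
    ((hΘd x).ofReal_comp).deriv
  simp_rw [h4] at h3
  have iφg : Integrable (fun x => φ x • g x) :=
    hg.integrable_smul_left_of_hasCompactSupport hφ.continuous hφc
  have iρg : Integrable (fun x => ρ x • g x) :=
    hg.integrable_smul_left_of_hasCompactSupport hρ.continuous hρc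
  have h5 : ∀ x, (θ x : ℂ) * g x = φ x • g x - (∫ y, φ y) • (ρ x • g x) := fun x => by
    simp only [hθ_def, Complex.real_smul]; push_cast; ring
  simp_rw [h5] at h3
  have iρg' : Integrable (fun x => (∫ y, φ y) • (ρ x • g x)) := iρg.smul (∫ y, φ y)
  rw [integral_sub iφg iρg', integral_smul, sub_eq_zero] at h3
  rw [h3, integral_smul_const]

theorem lax_apply (u : Lp ℂ 2 (volume : Measure ℝ)) (m : Lp ℂ ∞ (volume : Measure ℝ))
    (φ : 𝓢(ℝ, ℂ)) :
    lax u m φ = Complex.I * (∫ x, deriv φ x * m x) +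
      ∫ x, φ x * (u x * toeplitzConj u m x) := by
  have h1 : lax u m φ = (1 / Complex.I) * (∫ x, (-SchwartzMap.derivCLM ℂ ℂ φ) x • m x) +
      ∫ x, φ x • ((u • toeplitzConj u m : Lp ℂ 1 (volume : Measure ℝ)) x) := by
    rw [← Lp.toTemperedDistribution_apply, ← Lp.toTemperedDistribution_apply]
    rfl
  rw [h1]
  congr 1
  · have h2 : ∀ x, (-SchwartzMap.derivCLM ℂ ℂ φ) x • m x = -(deriv φ x * m x) := fun x => by
      rw [smul_eq_mul, ← neg_mul]; rfl
    simp_rw [h2]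
    rw [integral_neg, one_div, Complex.inv_I]; ring
  · refine integral_congr_ae ?_
    filter_upwards [Lp.coeFn_lpSMul (r := 1) u (toeplitzConj u m)] with x hx
    rw [hx]; rfl

theorem mem_generalizedEigenspace_iff (u : Lp ℂ 2 (volume : Measure ℝ)) (lam : ℝ)
    (m : Lp ℂ ∞ (volume : Measure ℝ)) :
    m ∈ generalizedEigenspace u lam ↔ m ∈ hardy ∞ ∧ ∀ φ : 𝓢(ℝ, ℂ),
      Complex.I * (∫ x, deriv φ x * m x) + ∫ x, φ x * (u x * toeplitzConj u m x) =
        lam * ∫ x, φ x * m x := by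
  have hr : ∀ φ : 𝓢(ℝ, ℂ), ((lam : ℂ) • (Lp.toTemperedDistributionCLM ℂ volume ∞ :
      Lp ℂ ∞ (volume : Measure ℝ) →L[ℂ] 𝓢'(ℝ, ℂ)).toLinearMap) m φ =
      lam * ∫ x, φ x * m x := fun φ => by
    have := Lp.toTemperedDistribution_apply m φ
    simp only [smul_eq_mul] at this
    rw [← this]; rfl
  rw [generalizedEigenspace, Submodule.mem_inf, LinearMap.mem_eqLocus]
  refine and_congr_right fun _ => ⟨fun h φ => ?_, fun h => ?_⟩
  · rw [← lax_apply, h, hr]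
  · refine DFunLike.ext _ _ fun φ => ?_
    rw [lax_apply, h, hr]

theorem modulate_wave (lam : ℝ) (ψ : 𝓢(ℝ, ℂ)) (x : ℝ) :
    modulate (-lam / (2 * Real.pi)) ψ x = (starRingEnd ℂ) (wave lam x) * ψ x := by
  have : (Real.pi : ℂ) ≠ 0 := by exact_mod_cast Real.pi_ne_zero
  rw [modulate_apply, conj_wave]
  congr 2
  push_cast; field_simp

theorem modulate_neg_modulate (a : ℝ) (φ : 𝓢(ℝ, ℂ)) : modulate a (modulate (-a) φ) = φ := by
  ext x
  rw [modulate_apply, modulate_apply, ← mul_assoc, ← Complex.exp_add]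
  rw [show (↑(2 * Real.pi * a * x) * Complex.I + ↑(2 * Real.pi * -a * x) * Complex.I : ℂ) = 0 by
    push_cast; ring, Complex.exp_zero, one_mul]

theorem deriv_modulate_wave (lam : ℝ) (ψ : 𝓢(ℝ, ℂ)) (x : ℝ) :
    deriv (modulate (-lam / (2 * Real.pi)) ψ) x =
      (starRingEnd ℂ) (wave lam x) * (deriv ψ x - Complex.I * lam * ψ x) := by
  have h1 : (modulate (-lam / (2 * Real.pi)) ψ : ℝ → ℂ) =
      fun x : ℝ => Complex.exp (-(Complex.I * lam * x)) * ψ x := by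
    funext y; rw [modulate_wave, conj_wave]
  have h2 : HasDerivAt (fun x : ℝ => -(Complex.I * lam * x)) (-(Complex.I * lam)) x := by
    have := ((hasDerivAt_id x).ofReal_comp.const_mul (Complex.I * lam)).fun_neg
    simpa using this
  rw [h1, (h2.cexp.fun_mul (ψ.hasDerivAt x)).deriv, conj_wave]
  ring

/-- The equation `L_u m = λ m` in terms of `f = e^{-iλx} m`. -/
theorem weak_equation_iff (u : Lp ℂ 2 (volume : Measure ℝ)) (lam : ℝ)
    (m : Lp ℂ ∞ (volume : Measure ℝ)) :
    (∀ φ : 𝓢(ℝ, ℂ), Complex.I * (∫ x, deriv φ x * m x) + ∫ x, φ x * (u x * toeplitzConj u m x) =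
        lam * ∫ x, φ x * m x) ↔
    ∀ ψ : 𝓢(ℝ, ℂ), ∫ x, deriv ψ x * ((starRingEnd ℂ) (wave lam x) * m x) =
      - ∫ x, ψ x * source (twist u lam) (toeplitzConj u m) x := by
  -- With this `a`, `modulate a` is multiplication by `e^{-iλx}`, a bijection of the Schwartz space;
  -- testing with `e^{-iλx} ψ` cancels the term `λm`.
  set a := -lam / (2 * Real.pi) with ha
  have hb : ∀ ψ : 𝓢(ℝ, ℂ), Integrable (fun x => ψ x * ((starRingEnd ℂ) (wave lam x) * m x)) :=
    fun ψ => by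
    have := integrable_schwartz_mul m (modulate a ψ)
    refine this.congr (Eventually.of_forall fun x => ?_)
    simp only [ha, modulate_wave]; ring
  have key : ∀ ψ : 𝓢(ℝ, ℂ),
      (Complex.I * (∫ x, deriv (modulate a ψ) x * m x) +
        ∫ x, (modulate a ψ) x * (u x * toeplitzConj u m x) = lam * ∫ x, (modulate a ψ) x * m x) ↔
      ∫ x, deriv ψ x * ((starRingEnd ℂ) (wave lam x) * m x) =
      - ∫ x, ψ x * source (twist u lam) (toeplitzConj u m) x := by
    intro ψ
    have e1 : ∫ x, deriv (modulate a ψ) x * m x =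
        (∫ x, deriv ψ x * ((starRingEnd ℂ) (wave lam x) * m x)) -
          Complex.I * lam * ∫ x, ψ x * ((starRingEnd ℂ) (wave lam x) * m x) := by
      have hbd : Integrable (fun x => deriv ψ x * ((starRingEnd ℂ) (wave lam x) * m x)) :=
        hb (SchwartzMap.derivCLM ℂ ℂ ψ)
      rw [← integral_const_mul, ← integral_sub hbd ((hb ψ).const_mul _)]
      congr 1; funext x
      rw [ha, deriv_modulate_wave]
      ring
    have e2 : ∫ x, (modulate a ψ) x * m x =
        ∫ x, ψ x * ((starRingEnd ℂ) (wave lam x) * m x) := by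
      congr 1; funext x
      rw [ha, modulate_wave]; ring
    have e3 : ∫ x, (modulate a ψ) x * (u x * toeplitzConj u m x) =
        Complex.I * ∫ x, ψ x * source (twist u lam) (toeplitzConj u m) x := by
      rw [← integral_const_mul]
      refine integral_congr_ae ?_
      filter_upwards [coeFn_twist u lam] with x hx
      rw [ha, modulate_wave, source, hx, map_mul, Complex.conj_conj]
      linear_combination ((starRingEnd ℂ) (wave lam x) * ψ x * u x * toeplitzConj u m x) *
        Complex.I_mul_I
    rw [e1, e2, e3]
    constructor
    · intro h
      refine mul_left_cancel₀ Complex.I_ne_zero ?_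
      linear_combination h + (lam * ∫ x, ψ x * ((starRingEnd ℂ) (wave lam x) * m x)) *
        Complex.I_mul_I
    · intro h
      rw [h]
      linear_combination (-lam * ∫ x, ψ x * ((starRingEnd ℂ) (wave lam x) * m x)) *
        Complex.I_mul_I
  refine ⟨fun h ψ => (key ψ).1 (h _), fun h φ => ?_⟩
  have := (key (modulate (-a) φ)).2 (h _)
  rwa [modulate_neg_modulate] at this

theorem coeFn_star_smul (u : Lp ℂ 2 (volume : Measure ℝ)) (m : Lp ℂ ∞ (volume : Measure ℝ)) :
    (star u • m : Lp ℂ 2 (volume : Measure ℝ)) =ᵐ[volume]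
      fun x => (starRingEnd ℂ) (u x) * m x := by
  filter_upwards [Lp.coeFn_lpSMul (r := 2) (star u) m, Lp.coeFn_star u] with x h1 h2
  rw [h1, Pi.smul_apply', h2]; rfl

theorem toeplitzConj_eq (u : Lp ℂ 2 (volume : Measure ℝ)) (m : Lp ℂ ∞ (volume : Measure ℝ)) :
    toeplitzConj u m = szego (star u • m) := rfl

/-- The integral form of the equation. -/
theorem exists_integral_form {u : Lp ℂ 2 (volume : Measure ℝ)} {lam : ℝ}
    {m : Lp ℂ ∞ (volume : Measure ℝ)} (hm : m ∈ generalizedEigenspace u lam) :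
    ∃ c : ℂ, m =ᵐ[volume] fun x => wave lam x *
      (c + primitive (source (twist u lam) (toeplitzConj u m)) x) := by
  have h := (weak_equation_iff u lam m).1 ((mem_generalizedEigenspace_iff u lam m).1 hm).2
  have hs := integrable_source (twist u lam) (toeplitzConj u m)
  set N := primitive (source (twist u lam) (toeplitzConj u m)) with hN_def
  have hN : Continuous N := continuous_primitive hs
  have hf : MemLp (fun x => (starRingEnd ℂ) (wave lam x) * m x) ∞ volume :=
    memLp_bounded_mul (Lp.memLp m)
      (Complex.continuous_conj.comp (continuous_wave lam)).aestronglyMeasurable (C := 1)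
      fun x => by simp [norm_wave]
  -- `e^{-iλx} m` and the primitive of the source have the same distributional derivative.
  obtain ⟨c, hc⟩ := exists_ae_eq_const
    (g := fun x => (starRingEnd ℂ) (wave lam x) * m x - N x)
    ((hf.locallyIntegrable le_top).sub hN.locallyIntegrable) fun ψ => by
      have i1 : Integrable (fun x => deriv ψ x * ((starRingEnd ℂ) (wave lam x) * m x)) := by
        have := integrable_schwartz_mul (hf.toLp _) (SchwartzMap.derivCLM ℂ ℂ ψ)
        refine this.congr ?_
        filter_upwards [hf.coeFn_toLp] with x hx
        rw [hx]; rfl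
      have i2 := integrable_mul_primitive ψ.integrable_deriv hs
      simp_rw [mul_sub]
      rw [integral_sub i1 i2, h, integral_deriv_mul_primitive ψ hs]
      simp_rw [mul_comm (ψ _)]
      ring
  refine ⟨c, ?_⟩
  filter_upwards [hc] with x hx
  rw [← hx, sub_add_cancel, ← mul_assoc, conj_wave, mul_comm (wave lam x), exp_mul_wave, one_mul]

theorem star_smul_ae_eq {u : Lp ℂ 2 (volume : Measure ℝ)} {lam : ℝ}
    {m : Lp ℂ ∞ (volume : Measure ℝ)} {f : ℝ → ℂ}
    (hm : m =ᵐ[volume] fun x => wave lam x * f x) :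
    (star u • m : Lp ℂ 2 (volume : Measure ℝ)) =ᵐ[volume] fun x => twist u lam x * f x := by
  filter_upwards [coeFn_star_smul u m, coeFn_twist u lam, hm] with x h1 h2 h3
  rw [h1, h2, h3]; ring

theorem memLp_wave_mul (w h : Lp ℂ 2 (volume : Measure ℝ)) (lam : ℝ) (c : ℂ) :
    MemLp (fun x => wave lam x * (c + primitive (source w h) x)) ∞ volume := by
  have hs := integrable_source w h
  refine memLp_top_of_bound ((continuous_wave lam).mul
    (continuous_const.add (continuous_primitive hs))).aestronglyMeasurable
    (‖c‖ + ‖w‖ * ‖h‖) (Eventually.of_forall fun x => ?_)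
  rw [norm_mul, norm_wave, one_mul]
  exact (norm_add_le _ _).trans (by gcongr; exact norm_primitive_source_le w h x)

/-- The function is a multiple of the plane wave plus the outgoing solution with source `u h`, a
product of two `L²_+` functions. The sign of `λ` matters only for the plane wave. -/
theorem isHardy_wave_mul {u h : Lp ℂ 2 (volume : Measure ℝ)} (hu : u ∈ hardy 2)
    (hh : h ∈ hardy 2) {lam : ℝ} (hlam : 0 ≤ lam) (c : ℂ) :
    IsHardy (fun x => wave lam x * (c + primitive (source (twist u lam) h) x)) := by
  have hi : Integrable (fun x => u x * h x) :=
    MemLp.integrable_mul (p := 2) (q := 2) (Lp.memLp u) (Lp.memLp h)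
  have h1 := (isHardy_mul hu hh).exp_mul_primitive hi lam
  have hs := integrable_source (twist u lam) h
  have e : ∀ x, primitive (source (twist u lam) h) x =
      -Complex.I * primitive (fun y => Complex.exp (-(Complex.I * lam * y)) * (u y * h y)) x := by
    intro x
    rw [primitive, primitive, ← integral_const_mul]
    refine integral_congr_ae (ae_restrict_of_ae ?_)
    filter_upwards [coeFn_twist u lam] with y hy
    rw [source, hy, map_mul, conj_wave, Complex.conj_conj]; ring
  intro φ hφ
  have i1 : Integrable (fun x => (𝓕 φ) x * wave lam x) :=
    integrable_mul_of_bounded (𝓕 φ).integrable (continuous_wave lam).aestronglyMeasurable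
      fun x => (norm_wave lam x).le
  have i2 : Integrable (fun x => ((𝓕 φ) x * wave lam x) *
      primitive (source (twist u lam) h) x) := integrable_mul_primitive i1 hs
  have z1 : ∫ x, (𝓕 φ) x * wave lam x = 0 := isHardy_exp hlam φ hφ
  have z2 : ∫ x, ((𝓕 φ) x * wave lam x) * primitive (source (twist u lam) h) x = 0 := by
    have := h1 φ hφ
    rw [← mul_zero (-Complex.I), ← this, ← integral_const_mul]
    congr 1; funext x
    rw [e, wave]; ring
  calc _ = ∫ x, (c * ((𝓕 φ) x * wave lam x) +
        ((𝓕 φ) x * wave lam x) * primitive (source (twist u lam) h) x) := by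
        congr 1; funext x; ring
    _ = 0 := by
        rw [integral_add (i1.const_mul _) i2, integral_const_mul, z1, z2, mul_zero, add_zero]

/-- Every solution of the integral equation is a generalized eigenfunction. -/
theorem exists_mem_of_solution {u : Lp ℂ 2 (volume : Measure ℝ)} (hu : u ∈ hardy 2) {lam : ℝ}
    (hlam : 0 ≤ lam) {c : ℂ} {p : Lp ℂ 2 (volume : Measure ℝ)}
    (hp : p =ᵐ[volume] fun x => twist u lam x *
      (c + primitive (source (twist u lam) (szego p)) x)) :
    ∃ m ∈ generalizedEigenspace u lam, m =ᵐ[volume] fun x => wave lam x *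
      (c + primitive (source (twist u lam) (szego p)) x) := by
  have hmem := memLp_wave_mul (twist u lam) (szego p) lam c
  set m := hmem.toLp _ with hm_def
  have hm : m =ᵐ[volume] fun x => wave lam x *
      (c + primitive (source (twist u lam) (szego p)) x) := hmem.coeFn_toLp
  -- Consistency: `p` is recovered as `ū m`, so the `Πp` in the formula for `m` is `T_ū m`.
  have hpm : star u • m = p := Lp.ext ((star_smul_ae_eq hm).trans hp.symm)
  have hs := integrable_source (twist u lam) (szego p)
  refine ⟨m, (mem_generalizedEigenspace_iff u lam m).2 ⟨?_, ?_⟩, hm⟩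
  · rw [mem_hardy_iff]
    exact (isHardy_wave_mul hu (szego_mem p) hlam c).congr_ae hm.symm
  · rw [weak_equation_iff, toeplitzConj_eq, hpm]
    intro ψ
    calc _ = ∫ x, (c * deriv ψ x + deriv ψ x * primitive (source (twist u lam) (szego p)) x) := by
          refine integral_congr_ae ?_
          filter_upwards [hm] with x hx
          rw [hx, ← mul_assoc ((starRingEnd ℂ) _), conj_wave, exp_mul_wave]; ring
      _ = _ := by
          rw [integral_add (ψ.integrable_deriv.const_mul _)
            (integrable_mul_primitive ψ.integrable_deriv hs), integral_const_mul,
            integral_deriv_schwartz, integral_deriv_mul_primitive ψ hs, mul_zero, zero_add]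
          simp_rw [mul_comm (ψ _)]

/-! ### Asymptotic values -/

theorem HasAsymptoticValue.unique {lam : ℝ} {m : Lp ℂ ∞ (volume : Measure ℝ)} {F : Filter ℝ}
    [F.NeBot] {ℓ ℓ' : ℂ} (h : HasAsymptoticValue lam m F ℓ) (h' : HasAsymptoticValue lam m F ℓ') :
    ℓ = ℓ' := by
  obtain ⟨f, hf, hmf, hl⟩ := h
  obtain ⟨f', hf', hmf', hl'⟩ := h'
  have : f = f' := (hf.ae_eq_iff_eq volume hf').1 (hmf.symm.trans hmf')
  subst this
  exact tendsto_nhds_unique hl hl'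

theorem HasAsymptoticValue.sub {lam : ℝ} {m m' : Lp ℂ ∞ (volume : Measure ℝ)} {F : Filter ℝ}
    {ℓ ℓ' : ℂ} (h : HasAsymptoticValue lam m F ℓ) (h' : HasAsymptoticValue lam m' F ℓ') :
    HasAsymptoticValue lam (m - m') F (ℓ - ℓ') := by
  obtain ⟨f, hf, hmf, hl⟩ := h
  obtain ⟨f', hf', hmf', hl'⟩ := h'
  refine ⟨f - f', hf.sub hf', (Lp.coeFn_sub m m').trans (hmf.sub hmf'), ?_⟩
  refine (hl.sub hl').congr fun x => ?_
  rw [Pi.sub_apply, mul_sub]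

theorem HasAsymptoticValue.smul {lam : ℝ} {m : Lp ℂ ∞ (volume : Measure ℝ)} {F : Filter ℝ}
    {ℓ : ℂ} (h : HasAsymptoticValue lam m F ℓ) (a : ℂ) :
    HasAsymptoticValue lam (a • m) F (a * ℓ) := by
  obtain ⟨f, hf, hmf, hl⟩ := h
  refine ⟨a • f, hf.const_smul a, (Lp.coeFn_smul a m).trans (hmf.const_smul a), ?_⟩
  refine (hl.const_mul a).congr fun x => ?_
  rw [Pi.smul_apply, smul_eq_mul, mul_left_comm]

theorem hasAsymptoticValue_of_integral_form {lam : ℝ} {m : Lp ℂ ∞ (volume : Measure ℝ)}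
    {w h : Lp ℂ 2 (volume : Measure ℝ)} {c : ℂ}
    (hm : m =ᵐ[volume] fun x => wave lam x * (c + primitive (source w h) x)) :
    HasAsymptoticValue lam m atBot c ∧
      HasAsymptoticValue lam m atTop (c + ∫ x, source w h x) := by
  have hs := integrable_source w h
  have hcont : Continuous (fun x => wave lam x * (c + primitive (source w h) x)) :=
    (continuous_wave lam).mul (continuous_const.add (continuous_primitive hs))
  have e : ∀ x : ℝ, c + primitive (source w h) x = Complex.exp (-(Complex.I * lam * x)) *
      (wave lam x * (c + primitive (source w h) x)) := fun x => by
    rw [← mul_assoc, exp_mul_wave, one_mul]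
  refine ⟨⟨_, hcont, hm, ?_⟩, ⟨_, hcont, hm, ?_⟩⟩
  · have := (tendsto_primitive_atBot hs).const_add c
    rw [add_zero] at this
    exact this.congr e
  · exact ((tendsto_primitive_atTop hs).const_add c).congr e

theorem exists_asymptoticValues {u : Lp ℂ 2 (volume : Measure ℝ)} {lam : ℝ}
    {m : Lp ℂ ∞ (volume : Measure ℝ)} (hm : m ∈ generalizedEigenspace u lam) :
    ∃ ℓminus ℓplus : ℂ, HasAsymptoticValue lam m atBot ℓminus ∧
      HasAsymptoticValue lam m atTop ℓplus ∧ ‖ℓplus‖ = ‖ℓminus‖ := by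
  obtain ⟨c, hc⟩ := exists_integral_form hm
  obtain ⟨h1, h2⟩ := hasAsymptoticValue_of_integral_form hc
  exact ⟨c, _, h1, h2, norm_add_integral_source (star_smul_ae_eq hc)⟩

/-- The limit at `-∞` is the constant of the integral form, so `eq_zero_of_vanishing` gives `ū m =
0`. The source then vanishes, and with it `m`, even where `u` is zero. -/
theorem eq_zero_of_hasAsymptoticValue_zero {α : ℝ} (hα : 0 < α)
    {u : Lp ℂ 2 (volume : Measure ℝ)} (hu : u ∈ weightedHardy α) {lam : ℝ}
    {m : Lp ℂ ∞ (volume : Measure ℝ)} (hm : m ∈ generalizedEigenspace u lam)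
    (h0 : HasAsymptoticValue lam m atBot 0) : m = 0 := by
  obtain ⟨c, hc⟩ := exists_integral_form hm
  have hc0 : c = 0 := (hasAsymptoticValue_of_integral_form hc).1.unique h0
  subst hc0
  have hp := star_smul_ae_eq (u := u) hc
  simp only [zero_add] at hp
  have hp0 := eq_zero_of_vanishing hα (memLp_weight_twist hα.le hu lam) hp
  rw [toeplitzConj_eq, hp0, map_zero] at hc
  have hs : ∀ x, primitive (source (twist u lam) (0 : Lp ℂ 2 (volume : Measure ℝ))) x = 0 :=
    fun x => by rw [← primitiveSourceCLM_apply, map_zero]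
  rw [Lp.eq_zero_iff_ae_eq_zero]
  filter_upwards [hc] with x hx
  rw [hx, hs]; simp

theorem exists_mem_hasAsymptoticValue {α : ℝ} (hα : 0 < α)
    {u : Lp ℂ 2 (volume : Measure ℝ)} (hu : u ∈ weightedHardy α) {lam : ℝ} (hlam : 0 ≤ lam)
    (ℓ : ℂ) : ∃ m ∈ generalizedEigenspace u lam, HasAsymptoticValue lam m atBot ℓ := by
  obtain ⟨p, hp⟩ := exists_solution hα (memLp_weight_twist hα.le hu lam) ℓ
  obtain ⟨m, hm, hm'⟩ := exists_mem_of_solution hu.1 hlam hp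
  exact ⟨m, hm, (hasAsymptoticValue_of_integral_form hm').1⟩

theorem eq_of_hasAsymptoticValue {α : ℝ} (hα : 0 < α)
    {u : Lp ℂ 2 (volume : Measure ℝ)} (hu : u ∈ weightedHardy α) {lam : ℝ}
    {m m' : Lp ℂ ∞ (volume : Measure ℝ)} (hm : m ∈ generalizedEigenspace u lam)
    (hm' : m' ∈ generalizedEigenspace u lam) {ℓ : ℂ} (h : HasAsymptoticValue lam m atBot ℓ)
    (h' : HasAsymptoticValue lam m' atBot ℓ) : m = m' := by
  have := h.sub h'
  rw [sub_self] at this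
  exact sub_eq_zero.1 (eq_zero_of_hasAsymptoticValue_zero hα hu (Submodule.sub_mem _ hm hm') this)

/-- The value at `-∞` is linear in `m` and determines it, so the element with value `1` spans the
space. -/
theorem finrank_generalizedEigenspace {α : ℝ} (hα : 0 < α)
    {u : Lp ℂ 2 (volume : Measure ℝ)} (hu : u ∈ weightedHardy α) {lam : ℝ} (hlam : 0 ≤ lam) :
    Module.finrank ℂ (generalizedEigenspace u lam) = 1 := by
  obtain ⟨m, hm, h1⟩ := exists_mem_hasAsymptoticValue hα hu hlam 1
  have hne : (⟨m, hm⟩ : generalizedEigenspace u lam) ≠ 0 := fun h => by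
    have h0 : m = 0 := congrArg Subtype.val h
    have h2 := h1.smul 0
    rw [zero_smul, ← h0] at h2
    simpa using h1.unique h2
  rw [finrank_eq_one_iff_of_nonzero' _ hne]
  rintro ⟨m', hm'⟩
  obtain ⟨ℓ, _, hℓ, _⟩ := exists_asymptoticValues hm'
  refine ⟨ℓ, Subtype.ext ?_⟩
  have h2 := h1.smul ℓ
  rw [mul_one] at h2
  exact eq_of_hasAsymptoticValue hα hu (Submodule.smul_mem _ _ hm) hm' h2 hℓ

end CMDNLS

end

theorem mainTheorem2 (α : ℝ) (hα : 0 < α)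
    (u : Lp ℂ 2 (volume : Measure ℝ)) (hu : u ∈ CMDNLS.weightedHardy α)
    (lam : ℝ) (hlam : 0 < lam) :
    Module.finrank ℂ (CMDNLS.generalizedEigenspace u lam) = 1 ∧
    (∀ m ∈ CMDNLS.generalizedEigenspace u lam, ∃ ℓminus ℓplus : ℂ,
      CMDNLS.HasAsymptoticValue lam m atBot ℓminus ∧
      CMDNLS.HasAsymptoticValue lam m atTop ℓplus ∧
      ‖ℓplus‖ = ‖ℓminus‖) ∧
    (∀ ℓ : ℂ, ∃! m : Lp ℂ ∞ (volume : Measure ℝ),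
      m ∈ CMDNLS.generalizedEigenspace u lam ∧
      CMDNLS.HasAsymptoticValue lam m atBot ℓ) := by
  refine ⟨CMDNLS.finrank_generalizedEigenspace hα hu hlam.le,
    fun m hm => CMDNLS.exists_asymptoticValues hm, fun ℓ => ?_⟩
  obtain ⟨m, hm, hℓ⟩ := CMDNLS.exists_mem_hasAsymptoticValue hα hu hlam.le ℓ
  exact ⟨m, ⟨hm, hℓ⟩, fun m' hm' => CMDNLS.eq_of_hasAsymptoticValue hα hu hm'.1 hm hm'.2 hℓ⟩
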